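/- **Setting.** An abduction instance $A=(B,O,S)$ consists of a finite list $B$ of Horn clauses $q(\bar Y)\Leftarrow p_1(\bar X^1)\wedge\dots\wedge p_r(\bar X^r)$ ($r\ge 1$, function-free atoms, every head variable occurs in the body), an observation $O$ (an existentially quantified finite conjunction of function-free atoms) and a finite set $S$ of constants, the sort names. $B$ is assumed to be acyclic: the relation "back-chaining over clause $a$ can produce an atom that can be back-chained over clause $a'$" on the clauses of $B$ has no cycle. The existential variables of $O$ are replaced by distinct new constants. Fix a total order $<$ on ground terms (e.g. the lexicographic one), and identify an atom $p(t_1,\dots,t_k)$ with the term $c(p,t_1,\dots,t_k)$. *Back-chaining* an atom $P$ over clause $a$, whose head it matches under a substitution of the head variables, adds the substituted body atoms, where the $j$-th variable that does not occur in the head becomes the Skolem term $s(a,j,\bar Y)$. *Unification* of two distinct atoms with the same predicate and arity, whose arguments at each position are equal or both not sort names, adds the equivalences between their differing arguments. The set $\hat{\mathcal H}(A)$ of hypotheses consists of the conjunctions of atoms and term equivalences obtained from $O$ by finitely many such steps. A *proof graph* $G$ w.r.t. $H\in\hat{\mathcal H}(A)$ has the atoms of $H$ as nodes and records the inference operations that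 generate $H$: back-chaining $P$ over clause $a$ gives edges, labelled with $a$, from the introduced body atoms to $P$; unification of $P$ and $Q$ gives a factoring edge in one of the two directions (from $P$ to $Q$ if $Q$ is factored with $P$). $G$ has to be acyclic, and each atom is back-chained over one clause, or factored with one atom, or neither. $A(G)$ is the set of nodes without incoming edge (the abduced atoms). The *Herbrand universe* of $A$ is the set of all terms that occur as arguments of atoms of hypotheses in $\hat{\mathcal H}(A)$. **The program.** $P_{\mathrm{bwda}}(A)$ is the following answer set program (FLP semantics with choice rules; $\mathit{not}$ is default negation). For each $o$ in $O$ the fact $goal(o)$; for each $n\in S$ the fact $sortname(n)$; for each clause with identifier $a$, with $Z_1,\dots,Z_v$ the variables occurring in its body but not in its head: - $mayInferVia(a,c(q,\bar Y),l(Z_1,\dots,Z_v))\leftarrow pot(c(q,\bar Y)), Z_1=s(a,1,\bar Y),\dots,Z_v=s(a,v,\bar Y)$ - $inferenceNeeds(c(q,\bar Y),a,c(p_i,\bar X^i))\leftarrow mayInferVia(a,c(q,\bar Y),l(Z_1,\dots,Z_v))$ for $1\le i\le r$ (in $s(a,j,\bar Y)$, if a head has constants among its arguments, only its variables are listed); the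 potential proof graph and the guess of the used part - $pot(X)\leftarrow goal(X)$; $\;pot(P)\leftarrow inferenceNeeds(\_,\_,P)$; $\;true(P)\leftarrow goal(P)$ - $1\le\{infer(P);fai(P)\}\le 1\leftarrow true(P)$ - $1\le\{inferVia(R,P):mayInferVia(R,P,\_)\}\le 1\leftarrow infer(P)$ - $true(Q)\leftarrow inferVia(R,P),inferenceNeeds(P,R,Q)$ the guess of the equivalence relation (the first rule for each arity $k$ occurring in $A$ and each $j\le k$) - $hu(X_j)\leftarrow pot(c(\_,X_1,\dots,X_k))$; $\;uhu(X)\leftarrow hu(X),\mathit{not}\ sortname(X)$ - $\{eq(X,Y):uhu(X),uhu(Y),X\ne Y\}\leftarrow$; $\;eq(X,X)\leftarrow hu(X)$; $\;\leftarrow eq(X,Y),\mathit{not}\ eq(Y,X)$ - $\leftarrow eq(X,Y),eq(Y,Z),X\ne Y,Y\ne Z,X\ne Z,\mathit{not}\ eq(X,Z)$ and cluster factoring (the first rule for each arity $k$ occurring in $A$) - $factorCluster(c(P,\bar Y),c(P,\bar X))\leftarrow fa(c(P,\bar X)),fa(c(P,\bar Y)),c(P,\bar X)<c(P,\bar Y),eq(X_1,Y_1),\dots,eq(X_k,Y_k)$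 - $factorClusterAbove(X)\leftarrow factorCluster(X,\_)$; $\;factorVia(X,Y)\leftarrow factorCluster(X,Y),\mathit{not}\ factorClusterAbove(Y)$ - $factor(P)\leftarrow factorVia(P,\_)$; $\;abduce(P)\leftarrow fa(P),\mathit{not}\ factor(P)$; $\;fa(P)\leftarrow fai(P)$. **Proposition.** The answer sets $I$ of $P_{\mathrm{bwda}}(A)$ are in one-to-one correspondence with the triples $(H,G,\sim)$ such that 1. $H\in\hat{\mathcal H}(A)$, and $G$ is a proof graph with respect to $H$; 2. $\sim$ is an equivalence relation on the Herbrand universe of $A$ in which the class of every sort name is a singleton, and $\sim$ supports the unifications, i.e. contains all equivalences of $H$; 3. factoring is performed only with atoms in $A(G)$ and only with smaller atoms with respect to $<$; 4. atoms are factored whenever possible: no two distinct atoms of $A(G)$ have the same predicate and arity and pairwise $\sim$-equivalent arguments. The correspondence reads off the nodes from $true$, the back-chaining edges and their labels from $inferVia$, the factoring of $X$ with $Y$ from $factorVia(X,Y)$, and $\sim$ from $eq$; $H$ consists of the nodes and of the equivalences due to the factorings. -/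

import Mathlib

universe u

/-! ## Answer set programs with function symbols and choice rules -/

namespace ASP

/-- Terms over function symbols `F` and variables `V`: variables, natural numbers and uninterpreted
function terms.  A constant is a function symbol without arguments. -/
inductive Term (F V : Type*) where
  | var (v : V)
  | num (n : ℕ)
  | app (f : F) (args : List (Term F V))

/-- Ground terms are the terms without variables. -/
abbrev GroundTerm (F : Type*) := Term F Empty

/-- Simultaneous substitution of terms for variables. -/
def Term.subst {F V W : Type*} (σ : V → Term F W) : Term F V → Term F W
  | .var v => σ v
  | .num n => .num n
  | .app f ts => .app f (ts.map fun t => t.subst σ)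

/-- Atoms `r(t₁,…,tₙ)` over predicate symbols `R`. -/
structure Atom (R F V : Type*) where
  pred : R
  args : List (Term F V)

abbrev GroundAtom (R F : Type*) := Atom R F Empty

def Atom.subst {R F V W : Type*} (σ : V → Term F W) (a : Atom R F V) : Atom R F W :=
  ⟨a.pred, a.args.map (Term.subst σ)⟩

/-- Body literals: atoms, default-negated atoms and the built-in comparisons. -/
inductive Literal (R F V : Type*) where
  | pos (a : Atom R F V)
  | naf (a : Atom R F V)
  | eq (t u : Term F V)
  | ne (t u : Term F V)
  | lt (t u : Term F V)

/-- An element `a : ℓ₁, …, ℓₖ` of a choice, with the list of its local variables, i.e. those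
which do not occur in the rest of the rule. -/
structure ChoiceElem (R F V : Type*) where
  atom : Atom R F V
  cond : List (Literal R F V)
  locals : List V

/-- Rule heads: a disjunction of atoms (the empty one yields a constraint),
or a choice `lower ≤ { e₁ ; … ; eₖ } ≤ upper`. -/
inductive Head (R F V : Type*) where
  | disj (as : List (Atom R F V))
  | choice (lower upper : ℕ∞) (es : List (ChoiceElem R F V))

structure Rule (R F V : Type*) where
  head : Head R F V
  body : List (Literal R F V)

/-- A program is a finite collection of rules. -/
abbrev Program (R F V : Type*) := List (Rule R F V)

abbrev Interpretation (R F : Type*) := Set (GroundAtom R F)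

section Semantics

variable {R F V : Type*} [LT (GroundTerm F)]

/-- Rules are instantiated with all ground terms of the signature; for safe rules, this yields the
same answer sets as the instantiation with the terms built from the symbols of the program.

`ℓ.Holds σ I`: the ground instance of `ℓ` under `σ` is true in `I`. The comparison `<` is
interpreted by the given order on ground terms. -/
def Literal.Holds (σ : V → GroundTerm F) (I : Interpretation R F) : Literal R F V → Prop
  | .pos a => a.subst σ ∈ I
  | .naf a => a.subst σ ∉ I
  | .eq t u => t.subst σ = u.subst σ
  | .ne t u => t.subst σ ≠ u.subst σ
  | .lt t u => t.subst σ < u.subst σ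

def BodyHolds (σ : V → GroundTerm F) (I : Interpretation R F) (b : List (Literal R F V)) : Prop :=
  ∀ l ∈ b, l.Holds σ I

/-- The instances of a choice element: the global variables are instantiated by `σ`, the local
ones arbitrarily. -/
def ChoiceElem.Instance (e : ChoiceElem R F V) (σ τ : V → GroundTerm F) : Prop :=
  ∀ v, v ∉ e.locals → τ v = σ v

/-- The atoms that are selected in `I` by a choice: those which are true in `I` and are the atom of
an instance of an element with true condition. -/
def selected (σ : V → GroundTerm F) (I : Interpretation R F) (es : List (ChoiceElem R F V)) :
    Set (GroundAtom R F) :=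
  {a | a ∈ I ∧ ∃ e ∈ es, ∃ τ, e.Instance σ τ ∧ BodyHolds τ I e.cond ∧ a = e.atom.subst τ}

/-- Satisfaction of an instantiated head; a choice requires that the number of selected atoms
is within the bounds. -/
def Head.Holds (σ : V → GroundTerm F) (I : Interpretation R F) : Head R F V → Prop
  | .disj as => ∃ a ∈ as, a.subst σ ∈ I
  | .choice lower upper es =>
      lower ≤ (selected σ I es).encard ∧ (selected σ I es).encard ≤ upper

/-- `I` is a model of all ground instances of the rules of `P`. -/
def IsModel (P : Program R F V) (I : Interpretation R F) : Prop :=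
  ∀ r ∈ P, ∀ σ : V → GroundTerm F, BodyHolds σ I r.body → r.head.Holds σ I

/-- What the head of a rule of the reduct with respect to `I` demands of `J`. A choice
`{ a : c ; … }` stands for the disjunctive rules `a ∨ â ← c, body` with a fresh atom `â` for
"`a` is not chosen", together with a constraint for the bounds; hence in the reduct it forces the
atoms that are selected in `I`, as far as their conditions remain true. -/
def Head.ReductHolds (σ : V → GroundTerm F) (I J : Interpretation R F) : Head R F V → Prop
  | .disj as => ∃ a ∈ as, a.subst σ ∈ J
  | .choice _ _ es => ∀ e ∈ es, ∀ τ, e.Instance σ τ → e.atom.subst τ ∈ I →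
      BodyHolds τ I e.cond → BodyHolds τ J e.cond → e.atom.subst τ ∈ J

/-- `J` is a model of the FLP-reduct `{ r ∈ grnd(P) | I ⊨ B(r) }`. -/
def IsReductModel (P : Program R F V) (I J : Interpretation R F) : Prop :=
  ∀ r ∈ P, ∀ σ : V → GroundTerm F,
    BodyHolds σ I r.body → BodyHolds σ J r.body → r.head.ReductHolds σ I J

/-- `I` is an answer set of `P`: it is a model of `P` and a minimal model of the FLP-reduct. -/
def IsAnswerSet (P : Program R F V) (I : Interpretation R F) : Prop :=
  IsModel P I ∧ ∀ J ⊆ I, IsReductModel P I J → J = I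

def answerSets (P : Program R F V) : Set (Interpretation R F) := {I | IsAnswerSet P I}

end Semantics

end ASP

/-! ## First-order Horn abduction -/

namespace Abduction

open ASP

/-- Function-free first-order terms. -/
inductive FOTerm (K : Type u) where
  | cst (k : K)
  | var (v : ℕ)

/-- First-order atoms; `K` is the set of names of constants and predicates. -/
structure FOAtom (K : Type u) where
  pred : K
  args : List (FOTerm K)

/-- The variables of a list of terms, in the order of their occurrence. -/
def varsOf {K : Type u} (ts : List (FOTerm K)) : List ℕ :=
  ts.filterMap fun t => match t with
    | .cst _ => none
    | .var v => some v

/-- A Horn clause `q(Y₁,…,Yₘ) ⇐ p₁(…) ∧ ⋯ ∧ pᵣ(…)` with `r ≥ 1`, all of whose head variables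
occur in the body. -/
structure HornClause (K : Type u) where
  head : FOAtom K
  body : List (FOAtom K)
  body_ne_nil : body ≠ []
  head_subset : ∀ v ∈ varsOf head.args, ∃ p ∈ body, v ∈ varsOf p.args

/-- An abduction instance `(B, O, S)`; the variables of the observation `O` are existentially
quantified. -/
structure AbductionInstance (K : Type u) where
  B : List (HornClause K)
  O : List (FOAtom K)
  S : List K

/-- Constants and function symbols: the names in `K`, a constant for each existentially quantified
variable of the observation, an identifier for each clause of the background theory, and the
auxiliary symbols `c` (encoded atoms), `l` (lists of Skolem terms), `s` (Skolem terms). -/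
inductive Sym (K : Type u) where
  | name (k : K)
  | obs (v : ℕ)
  | clause (i : ℕ)
  | c
  | l
  | s

/-- The terms in hypotheses: names, constants of observation variables, and Skolem terms. -/
abbrev HTerm (K : Type u) := GroundTerm (Sym K)

/-- The atoms in hypotheses and proof graphs. -/
structure HAtom (K : Type u) where
  pred : K
  args : List (HTerm K)

section

variable {K : Type u}

def FOTerm.inst (σ : ℕ → HTerm K) : FOTerm K → HTerm K
  | .cst k => .app (.name k) []
  | .var v => σ v

def FOAtom.inst (σ : ℕ → HTerm K) (a : FOAtom K) : HAtom K :=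
  ⟨a.pred, a.args.map (FOTerm.inst σ)⟩

namespace HornClause

/-- The variables `Y` of the head, in the order of their occurrence. -/
def headVars (r : HornClause K) : List ℕ := varsOf r.head.args

/-- The variables `Z₁,…,Zᵥ` that occur in the body but not in the head, without repetitions. -/
def exVars (r : HornClause K) : List ℕ :=
  ((r.body.flatMap fun p => varsOf p.args).filter fun v => v ∉ r.headVars).dedup

end HornClause

namespace AbductionInstance

variable (A : AbductionInstance K)

/-- The observation, with a constant for each existentially quantified variable. -/
def goals : Set (HAtom K) :=
  {P | ∃ o ∈ A.O, P = o.inst fun v => .app (.obs v) []}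

/-- The sort names as terms. -/
def sorts : Set (HTerm K) := {t | ∃ k ∈ A.S, t = .app (.name k) []}

/-- The substitution of back-chaining over clause `i`: it agrees with `σ` on the head variables,
and maps the `j`-th existential variable to the Skolem term `s(i, j, Y₁, …, Yₘ)`. -/
def skolemSubst (i : Fin A.B.length) (σ : ℕ → HTerm K) (v : ℕ) : HTerm K :=
  if v ∈ (A.B.get i).headVars then σ v
  else .app .s (.app (.clause i) [] :: .num ((A.B.get i).exVars.idxOf v + 1) ::
    (A.B.get i).headVars.map σ)

/-- The atom `P` can be back-chained over clause `i`: it matches the head. -/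
def Applicable (i : Fin A.B.length) (P : HAtom K) : Prop :=
  ∃ σ, (A.B.get i).head.inst σ = P

/-- The substituted body atoms that back-chaining of `P` over clause `i` introduces. -/
def bodyAtoms (i : Fin A.B.length) (P : HAtom K) : Set (HAtom K) :=
  {Q | ∃ σ, (A.B.get i).head.inst σ = P ∧
    ∃ p ∈ (A.B.get i).body, Q = p.inst (A.skolemSubst i σ)}

/-- Back-chaining over clause `i` can produce an atom that can be back-chained over clause `j`. -/
def DependsOn (i j : Fin A.B.length) : Prop :=
  ∃ P, ∃ Q ∈ A.bodyAtoms i P, A.Applicable j Q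

/-- The background theory is acyclic: there are no circular inferences over its clauses. -/
def Acyclic : Prop := ∀ i, ¬ Relation.TransGen A.DependsOn i i

end AbductionInstance

/-- A hypothesis: a conjunction (represented as a set) of atoms and of equivalences between
terms. -/
@[ext]
structure Hypothesis (K : Type u) where
  atoms : Set (HAtom K)
  eqs : Set (Sym2 (HTerm K))

/-- The equivalences `X = Y` that are needed in order to identify the atoms `P` and `Q`
argument by argument. -/
def unifEqs (P Q : HAtom K) : Set (Sym2 (HTerm K)) :=
  {e | ∃ x y, (x, y) ∈ P.args.zip Q.args ∧ x ≠ y ∧ e = s(x, y)}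

namespace AbductionInstance

variable (A : AbductionInstance K)

/-- `P` and `Q` unify without an equivalence that involves a sort name. -/
def Unifiable (P Q : HAtom K) : Prop :=
  P.pred = Q.pred ∧
    List.Forall₂ (fun x y => x = y ∨ (x ∉ A.sorts ∧ y ∉ A.sorts)) P.args Q.args

/-- The hypotheses of an abduction instance: they are obtained from the observation by
back-chaining and unification. -/
inductive IsHypothesis : Hypothesis K → Prop
  | observation : IsHypothesis ⟨A.goals, ∅⟩
  | backchain {H : Hypothesis K} (hH : IsHypothesis H) {P : HAtom K} (hP : P ∈ H.atoms)
      {i : Fin A.B.length} (hi : A.Applicable i P) :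
      IsHypothesis ⟨H.atoms ∪ A.bodyAtoms i P, H.eqs⟩
  | unify {H : Hypothesis K} (hH : IsHypothesis H) {P Q : HAtom K} (hP : P ∈ H.atoms)
      (hQ : Q ∈ H.atoms) (hne : P ≠ Q) (hu : A.Unifiable P Q) :
      IsHypothesis ⟨H.atoms, H.eqs ∪ unifEqs P Q⟩

/-- The set of all hypotheses. -/
def hypotheses : Set (Hypothesis K) := {H | A.IsHypothesis H}

/-- The terms that occur in the atoms of hypotheses. -/
def herbrandTerms : Set (HTerm K) :=
  {t | ∃ H ∈ A.hypotheses, ∃ P ∈ H.atoms, t ∈ P.args}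

end AbductionInstance

/-- A graph of inferences over the instance `A`: the nodes, the back-chaining inferences
(`(i, P) ∈ via`: node `P` is back-chained over clause `i`), and the factorings (`(Q, P) ∈ fac`:
node `Q` is factored with node `P`). -/
@[ext]
structure InferenceGraph (A : AbductionInstance K) where
  nodes : Set (HAtom K)
  via : Set (Fin A.B.length × HAtom K)
  fac : Set (HAtom K × HAtom K)

namespace InferenceGraph

variable {A : AbductionInstance K} (G : InferenceGraph A)

/-- The edges, which lead from the justifying to the justified atom: back-chaining of `P` induces
an edge from each body atom to `P`, and factoring `Q` with `P` induces an edge from `P` to `Q`. -/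
def Edge (a b : HAtom K) : Prop :=
  (∃ i, (i, b) ∈ G.via ∧ a ∈ A.bodyAtoms i b) ∨ (b, a) ∈ G.fac

/-- The nodes `A(G)` that are neither back-chained nor factored. -/
def abduced : Set (HAtom K) := {a | a ∈ G.nodes ∧ ¬ ∃ b, G.Edge b a}

end InferenceGraph

/-- `GeneratedBy A H G`: a sequence of back-chainings and unifications that starts from the
observation generates the hypothesis `H`, and `G` consists of the atoms of `H` and records these
inference operations. A unification of two atoms is recorded in one of the two directions. -/
inductive GeneratedBy (A : AbductionInstance K) : Hypothesis K → InferenceGraph A → Prop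
  | observation : GeneratedBy A ⟨A.goals, ∅⟩ ⟨A.goals, ∅, ∅⟩
  | backchain {H : Hypothesis K} {G : InferenceGraph A} (h : GeneratedBy A H G) {P : HAtom K}
      (hP : P ∈ H.atoms) {i : Fin A.B.length} (hi : A.Applicable i P) :
      GeneratedBy A ⟨H.atoms ∪ A.bodyAtoms i P, H.eqs⟩
        ⟨G.nodes ∪ A.bodyAtoms i P, insert (i, P) G.via, G.fac⟩
  | unify {H : Hypothesis K} {G : InferenceGraph A} (h : GeneratedBy A H G) {P Q : HAtom K}
      (hP : P ∈ H.atoms) (hQ : Q ∈ H.atoms) (hne : P ≠ Q) (hu : A.Unifiable P Q) :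
      GeneratedBy A ⟨H.atoms, H.eqs ∪ unifEqs P Q⟩ ⟨G.nodes, G.via, insert (Q, P) G.fac⟩

/-- `G` is a proof graph with respect to the hypothesis `H`: it is acyclic, it is induced by the
inference operations that generate `H`, and each atom is justified by a single inference,
or by a single factoring, or not at all. -/
structure IsProofGraph (A : AbductionInstance K) (H : Hypothesis K) (G : InferenceGraph A) :
    Prop where
  generated : GeneratedBy A H G
  acyclic : ∀ a, ¬ Relation.TransGen G.Edge a a
  via_unique : ∀ P i j, (i, P) ∈ G.via → (j, P) ∈ G.via → i = j
  fac_unique : ∀ P Q Q', (P, Q) ∈ G.fac → (P, Q') ∈ G.fac → Q = Q'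
  via_or_fac : ∀ P i Q, (i, P) ∈ G.via → (P, Q) ∉ G.fac

/-- `E` is an equivalence relation on the terms of the hypotheses of `A` in which each sort name
is equivalent to itself only. -/
structure IsTermEquivalence (A : AbductionInstance K) (E : Set (HTerm K × HTerm K)) : Prop where
  mem_terms : ∀ x y, (x, y) ∈ E → x ∈ A.herbrandTerms ∧ y ∈ A.herbrandTerms
  refl : ∀ x ∈ A.herbrandTerms, (x, x) ∈ E
  symm : ∀ x y, (x, y) ∈ E → (y, x) ∈ E
  trans : ∀ x y z, (x, y) ∈ E → (y, z) ∈ E → (x, z) ∈ E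
  sort_singleton : ∀ x y, (x, y) ∈ E → x ∈ A.sorts → y = x

/-- `P` and `Q` coincide up to the equivalence `E` of terms. -/
def UnifyUnder (E : Set (HTerm K × HTerm K)) (P Q : HAtom K) : Prop :=
  P.pred = Q.pred ∧ List.Forall₂ (fun x y => (x, y) ∈ E) P.args Q.args

/-- The encoding of an atom `p(t₁,…,tₙ)` as the term `c(p,t₁,…,tₙ)`. -/
def HAtom.encode (P : HAtom K) : HTerm K := .app .c (.app (.name P.pred) [] :: P.args)

/-- An explanation: a hypothesis, a graph of inferences and an equivalence relation on terms. -/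
@[ext]
structure Explanation (A : AbductionInstance K) where
  hyp : Hypothesis K
  graph : InferenceGraph A
  equiv : Set (HTerm K × HTerm K)

/-- The explanations that are counted: `graph` is a proof graph with respect to the hypothesis
`hyp`, `equiv` is an equivalence of terms that supports the unifications, factoring happens only
with atoms in `A(G)` and only with smaller atoms, and two unifiable atoms never both remain
abduced. -/
structure Explanation.IsCanonical {A : AbductionInstance K} [LT (HTerm K)] (X : Explanation A) :
    Prop where
  hyp_mem : X.hyp ∈ A.hypotheses
  proofGraph : IsProofGraph A X.hyp X.graph
  termEquiv : IsTermEquivalence A X.equiv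
  supported : ∀ x y, s(x, y) ∈ X.hyp.eqs → (x, y) ∈ X.equiv
  fac_abduced : ∀ Q P, (Q, P) ∈ X.graph.fac → P ∈ X.graph.abduced
  fac_smaller : ∀ Q P, (Q, P) ∈ X.graph.fac → P.encode < Q.encode
  fac_complete : ∀ Q ∈ X.graph.abduced, ∀ P ∈ X.graph.abduced, P.encode < Q.encode →
    ¬ UnifyUnder X.equiv P Q

end

/-! ## The encoding -/

/-- The predicates of the encoding. -/
inductive Pd where
  | goal | sortname | pot | hu | uhu | eq | mayInferVia | inferenceNeeds
  | tru | infer | fai | inferVia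
  | fa | factorCluster | factorClusterAbove | factorVia | factor | abduce

section Encoding

variable {K : Type u}

/-- Terms and rules of the encoding; variables are natural numbers. -/
abbrev PTerm (K : Type u) := Term (Sym K) ℕ
abbrev PAtom (K : Type u) := Atom Pd (Sym K) ℕ
abbrev PRule (K : Type u) := Rule Pd (Sym K) ℕ

/-- The constant `f`. -/
def con {V : Type*} (f : Sym K) : Term (Sym K) V := .app f []

/-- The rule variable `n`. -/
def pv (n : ℕ) : PTerm K := .var n

/-- An atom as a positive body literal. -/
def lit (p : Pd) (ts : List (PTerm K)) : Literal Pd (Sym K) ℕ := .pos ⟨p, ts⟩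

/-- An atom as a negative body literal. -/
def nlit (p : Pd) (ts : List (PTerm K)) : Literal Pd (Sym K) ℕ := .naf ⟨p, ts⟩

/-- The rule `p(ts) ← body`. -/
def nrule (p : Pd) (ts : List (PTerm K)) (body : List (Literal Pd (Sym K) ℕ)) : PRule K :=
  ⟨.disj [⟨p, ts⟩], body⟩

/-- The constraint `← body`. -/
def constraint (body : List (Literal Pd (Sym K) ℕ)) : PRule K := ⟨.disj [], body⟩

/-- A first-order term as a term of the encoding. -/
def FOTerm.toP : FOTerm K → PTerm K
  | .cst k => con (.name k)
  | .var v => pv v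

/-- The term `c(p, t₁, …, tₙ)` for an atom of a clause. -/
def FOAtom.toP (a : FOAtom K) : PTerm K :=
  .app .c (con (.name a.pred) :: a.args.map FOTerm.toP)

/-- The same for an atom of the observation, whose variables become constants. -/
def FOAtom.toGoal (a : FOAtom K) : PTerm K :=
  .app .c (con (.name a.pred) :: a.args.map fun t => match t with
    | .cst k => con (.name k)
    | .var v => con (.obs v))

/-- The rewriting of the clause with identifier `i`:
```
mayInferVia(i, c(q,Ȳ), l(Z₁,…,Zᵥ)) ← pot(c(q,Ȳ)), Z₁ = s(i,1,Ȳ), …, Zᵥ = s(i,v,Ȳ).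
inferenceNeeds(c(q,Ȳ), i, c(p,X̄)) ← mayInferVia(i, c(q,Ȳ), l(Z₁,…,Zᵥ)).   (for each body atom)
```
-/
def clauseRules (i : ℕ) (r : HornClause K) : Program Pd (Sym K) ℕ :=
  let zs : PTerm K := .app .l (r.exVars.map pv)
  nrule .mayInferVia [con (.clause i), r.head.toP, zs]
      (lit .pot [r.head.toP] ::
        r.exVars.mapIdx fun j z =>
          .eq (pv z) (.app .s (con (.clause i) :: .num (j + 1) :: r.headVars.map pv))) ::
    r.body.map fun p =>
      nrule .inferenceNeeds [r.head.toP, con (.clause i), p.toP]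
        [lit .mayInferVia [con (.clause i), r.head.toP, zs]]

/-- The arities of the atoms of the background theory and of the observation. -/
def AbductionInstance.arities (A : AbductionInstance K) : List ℕ :=
  ((A.O ++ A.B.flatMap fun r => r.head :: r.body).map fun a => a.args.length).dedup

/-- The rewriting of the background theory, the observation and the sort names. -/
def progBos (A : AbductionInstance K) : Program Pd (Sym K) ℕ :=
  (A.B.mapIdx clauseRules).flatten ++
  (A.O.map fun o => nrule .goal [o.toGoal] []) ++
  (A.S.map fun k => nrule .sortname [con (.name k)] [])

/-- The potential proof graph:
```
pot(X) ← goal(X).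
pot(P) ← inferenceNeeds(_, _, P).
```
-/
def progBpt (A : AbductionInstance K) : Program Pd (Sym K) ℕ :=
  progBos A ++
  [nrule .pot [pv 0] [lit .goal [pv 0]],
   nrule .pot [pv 2] [lit .inferenceNeeds [pv 0, pv 1, pv 2]]]

/-- The guess of the used part of the potential proof graph:
```
true(P) ← goal(P).
1 ≤ { infer(P) ; fai(P) } ≤ 1 ← true(P).
1 ≤ { inferVia(R,P) : mayInferVia(R,P,_) } ≤ 1 ← infer(P).
true(Q) ← inferVia(R,P), inferenceNeeds(P,R,Q).
```
-/
def progGp : Program Pd (Sym K) ℕ :=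
  [nrule .tru [pv 0] [lit .goal [pv 0]],
   ⟨.choice 1 1 [⟨⟨.infer, [pv 0]⟩, [], []⟩, ⟨⟨.fai, [pv 0]⟩, [], []⟩], [lit .tru [pv 0]]⟩,
   ⟨.choice 1 1 [⟨⟨.inferVia, [pv 1, pv 0]⟩, [lit .mayInferVia [pv 1, pv 0, pv 2]], [1, 2]⟩],
      [lit .infer [pv 0]]⟩,
   nrule .tru [pv 2] [lit .inferVia [pv 1, pv 0], lit .inferenceNeeds [pv 0, pv 1, pv 2]]]

/-- The term `c(P, X₁, …, Xₖ)`, with the rule variable `0` for `P` and the variables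
`offset + 1, …, offset + k` for the arguments. -/
def generalAtom (k offset : ℕ) : PTerm K :=
  .app .c (pv 0 :: (List.range k).map fun j => pv (offset + j + 1))

/-- The guess of the equivalence relation (the first line for each arity `k` and `1 ≤ j ≤ k`):
```
hu(Xⱼ) ← pot(c(P,X₁,…,Xₖ)).
uhu(X) ← hu(X), not sortname(X).
{ eq(A,B) : uhu(A), uhu(B), A ≠ B } ← .
eq(A,A) ← hu(A).
← eq(A,B), not eq(B,A).
← eq(A,B), eq(B,C), A ≠ B, B ≠ C, A ≠ C, not eq(A,C).
```
-/
def progEq (A : AbductionInstance K) : Program Pd (Sym K) ℕ :=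
  (A.arities.flatMap fun k => (List.range k).map fun j =>
    nrule .hu [pv (j + 1)] [lit .pot [generalAtom k 0]]) ++
  [nrule .uhu [pv 0] [lit .hu [pv 0], nlit .sortname [pv 0]],
   ⟨.choice 0 ⊤ [⟨⟨.eq, [pv 0, pv 1]⟩,
      [lit .uhu [pv 0], lit .uhu [pv 1], .ne (pv 0) (pv 1)], [0, 1]⟩], []⟩,
   nrule .eq [pv 0, pv 0] [lit .hu [pv 0]],
   constraint [lit .eq [pv 0, pv 1], nlit .eq [pv 1, pv 0]],
   constraint [lit .eq [pv 0, pv 1], lit .eq [pv 1, pv 2], .ne (pv 0) (pv 1), .ne (pv 1) (pv 2),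
      .ne (pv 0) (pv 2), nlit .eq [pv 0, pv 2]]]

/-- Cluster factoring (the first rule for each arity `k`):
```
factorCluster(c(P,Y₁,…,Yₖ), c(P,X₁,…,Xₖ)) ←
  fa(c(P,X₁,…,Xₖ)), fa(c(P,Y₁,…,Yₖ)), c(P,X₁,…,Xₖ) < c(P,Y₁,…,Yₖ), eq(X₁,Y₁), …, eq(Xₖ,Yₖ).
factorClusterAbove(A) ← factorCluster(A,_).
factorVia(A,B) ← factorCluster(A,B), not factorClusterAbove(B).
factor(P) ← factorVia(P,_).
abduce(P) ← fa(P), not factor(P).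
fa(P) ← fai(P).
```
-/
def progC (A : AbductionInstance K) : Program Pd (Sym K) ℕ :=
  (A.arities.map fun k =>
    nrule .factorCluster [generalAtom k k, generalAtom k 0]
      (lit .fa [generalAtom k 0] :: lit .fa [generalAtom k k] ::
        .lt (generalAtom k 0) (generalAtom k k) ::
        (List.range k).map fun j => lit .eq [pv (j + 1), pv (k + j + 1)])) ++
  [nrule .factorClusterAbove [pv 0] [lit .factorCluster [pv 0, pv 1]],
   nrule .factorVia [pv 0, pv 1]
      [lit .factorCluster [pv 0, pv 1], nlit .factorClusterAbove [pv 1]],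
   nrule .factor [pv 0] [lit .factorVia [pv 0, pv 1]],
   nrule .abduce [pv 0] [lit .fa [pv 0], nlit .factor [pv 0]],
   nrule .fa [pv 0] [lit .fai [pv 0]]]

/-- The complete encoding with abduced cluster factoring. -/
def progBwda (A : AbductionInstance K) : Program Pd (Sym K) ℕ :=
  progBpt A ++ progGp ++ progEq A ++ progC A

/-- The explanation that an interpretation represents: the nodes are given by `true`, the
back-chaining inferences by `inferVia`, the factorings by `factorVia`, and the equivalence relation
by `eq`; the hypothesis consists of the nodes and of the equivalences due to factoring. -/
def readOff (A : AbductionInstance K) (I : Interpretation Pd (Sym K)) : Explanation A where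
  hyp :=
    { atoms := {P | ⟨.tru, [P.encode]⟩ ∈ I}
      eqs := {e | ∃ Q P : HAtom K, ⟨.factorVia, [Q.encode, P.encode]⟩ ∈ I ∧ e ∈ unifEqs P Q} }
  graph :=
    { nodes := {P | ⟨.tru, [P.encode]⟩ ∈ I}
      via := {x | ⟨.inferVia, [con (.clause x.1), x.2.encode]⟩ ∈ I}
      fac := {x | ⟨.factorVia, [x.1.encode, x.2.encode]⟩ ∈ I} }
  equiv := {x | ⟨.eq, [x.1, x.2]⟩ ∈ I}

end Encoding

end Abduction

/-! Both sides of the correspondence are parametrised by the same data: a set `V` of back-chainings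
and an equivalence `E` on Herbrand terms. Call the pair admissible (`IsAdmissible`) if every member
of `V` is an applicable inference on an atom derivable from the observation through `V`, each atom
has at most one clause in `V`, and `E` is a term equivalence with singleton sort classes. Everything
else is forced. The nodes are the atoms derivable through `V`; an atom of the observation or of a
chosen body that is not back-chained takes part in factoring, and it is factored with the least such
atom that is `E`-equivalent to it, unless it is itself the least. So `V` and `E` determine an
interpretation `interp V E` and an explanation `explain V E`, and `readOff` sends one to the other
(`readOff_interp`).

It remains to see that the answer sets are exactly the `interp V E`, and the canonical explanations
exactly the `explain V E`, with `(V, E)` admissible. For answer sets, all heads are single atoms,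
empty, or choices, so `isAnswerSet_iff` turns the FLP semantics into: closed under the one-step
derivations `Step`, within the bounds of choices and constraints, and without a smaller set closed
in the reduct. Any such closed set that makes the relevant choices contains `interp V E`
(`interp_subset_of_closed`). This gives minimality of `interp V E` and one half of
`IsAnswerSet.eq_interp`; the other half comes from minimality, which provides support and founded
derivations for the atoms of an answer set.

For explanations, transitivity of `E` shows that the three factoring conditions leave only factoring
with the least atom of a cluster (`Explanation.IsCanonical.eq_explain`). Acyclicity of the theory is
needed for the converse, `IsAdmissible.isCanonical`: it makes the potential proof graph finite, so
that finitely many steps generate the hypothesis and clusters have least elements, and it excludes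
cycles in the graph. -/

namespace ASP

/-! ### Programs with single-atom, empty or choice heads: models and reduct models as closed sets -/

section Semantics

variable {R F V : Type*} [LT (GroundTerm F)]

/-- The atom `a` is an atom of the head instance, and, if the head is a choice, it is selected. -/
def Head.Yields (σ : V → GroundTerm F) (I J : Interpretation R F) (a : GroundAtom R F) :
    Head R F V → Prop
  | .disj as => ∃ b ∈ as, b.subst σ = a
  | .choice _ _ es => ∃ e ∈ es, ∃ τ, e.Instance σ τ ∧ BodyHolds τ I e.cond ∧
      BodyHolds τ J e.cond ∧ e.atom.subst τ = a ∧ a ∈ I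

/-- One-step derivation from `J` in the reduct with respect to `I`. -/
def Derives (P : Program R F V) (I J : Interpretation R F) (a : GroundAtom R F) : Prop :=
  ∃ r ∈ P, ∃ σ, BodyHolds σ I r.body ∧ BodyHolds σ J r.body ∧ r.head.Yields σ I J a

/-- Heads that are choices or disjunctions of at most one atom. -/
def Head.IsNormal : Head R F V → Prop
  | .disj as => as.length ≤ 1
  | .choice _ _ _ => True

/-- The part of the model condition that concerns constraints and the bounds of choices. -/
def Head.Admissible (σ : V → GroundTerm F) (I : Interpretation R F) : Head R F V → Prop
  | .disj as => as ≠ []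
  | .choice lower upper es =>
      lower ≤ (selected σ I es).encard ∧ (selected σ I es).encard ≤ upper

/-- With at most one atom per disjunction there is no choice of which head atom to make true, so
satisfaction splits into closure under derivation and the conditions that only restrict `I`. -/
theorem isModel_iff {P : Program R F V} (hP : ∀ r ∈ P, r.head.IsNormal)
    (I : Interpretation R F) :
    IsModel P I ↔ (∀ a, Derives P I I a → a ∈ I) ∧
      ∀ r ∈ P, ∀ σ, BodyHolds σ I r.body → r.head.Admissible σ I := by
  constructor
  · intro h
    refine ⟨?_, ?_⟩
    · rintro a ⟨r, hr, σ, hb, -, hy⟩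
      have hn := hP r hr
      have hm := h r hr σ hb
      rcases r with ⟨as | ⟨l, u, es⟩, b⟩
      · obtain ⟨b, hb, rfl⟩ := hy
        obtain ⟨b', hb', hI⟩ := hm
        match as, hn, hb, hb' with
        | [c], _, hb, hb' =>
          simp only [List.mem_singleton] at hb hb'
          subst hb hb'
          exact hI
      · obtain ⟨-, -, -, -, -, -, -, hI⟩ := hy
        exact hI
    · intro r hr σ hb
      have hm := h r hr σ hb
      rcases r with ⟨as | ⟨l, u, es⟩, b⟩
      · obtain ⟨b', hb', -⟩ := hm
        exact List.ne_nil_of_mem hb'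
      · exact hm
  · rintro ⟨h, h'⟩ r hr σ hb
    have hm := h' r hr σ hb
    have hd := fun a hy => h a ⟨r, hr, σ, hb, hb, hy⟩
    rcases r with ⟨as | ⟨l, u, es⟩, b⟩
    · obtain ⟨b, hb⟩ := List.exists_mem_of_ne_nil as hm
      exact ⟨b, hb, hd _ ⟨b, hb, rfl⟩⟩
    · exact hm

/-- Constraints drop out of the reduct because `I` is a model: no instance of a rule with empty head
has a body true in `I`. Bounds play no role in the reduct by definition, so only closure is left. -/
theorem IsModel.isReductModel_iff {P : Program R F V} (hP : ∀ r ∈ P, r.head.IsNormal)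
    {I : Interpretation R F} (hI : IsModel P I) (J : Interpretation R F) :
    IsReductModel P I J ↔ ∀ a, Derives P I J a → a ∈ J := by
  constructor
  · rintro h a ⟨r, hr, σ, hb, hbJ, hy⟩
    have hn := hP r hr
    have hm := h r hr σ hb hbJ
    rcases r with ⟨as | ⟨l, u, es⟩, b⟩
    · obtain ⟨b, hb, rfl⟩ := hy
      obtain ⟨b', hb', hI⟩ := hm
      match as, hn, hb, hb' with
      | [c], _, hb, hb' =>
        simp only [List.mem_singleton] at hb hb'
        subst hb hb'
        exact hI
    · obtain ⟨e, he, τ, hτ, hc, hcJ, rfl, hI⟩ := hy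
      exact hm e he τ hτ hI hc hcJ
  · intro h r hr σ hb hbJ
    have hm := hI r hr σ hb
    have hd := fun a hy => h a ⟨r, hr, σ, hb, hbJ, hy⟩
    rcases r with ⟨as | ⟨l, u, es⟩, b⟩
    · obtain ⟨b, hb, -⟩ := hm
      exact ⟨b, hb, hd _ ⟨b, hb, rfl⟩⟩
    · intro e he τ hτ ha hc hcJ
      exact hd _ ⟨e, he, τ, hτ, hc, hcJ, rfl, ha⟩

end Semantics

end ASP

/-! ### Ground instances of the encoded terms, and Skolem substitutions -/

namespace Abduction

open ASP

variable {K : Type u}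

theorem HAtom.encode_injective : Function.Injective (HAtom.encode (K := K)) := by
  rintro ⟨p, xs⟩ ⟨q, ys⟩ h
  simp only [HAtom.encode, Term.app.injEq, List.cons.injEq, Sym.name.injEq, and_true,
    true_and] at h
  rw [h.1, h.2]

@[simp] theorem HAtom.encode_inj {P Q : HAtom K} : P.encode = Q.encode ↔ P = Q :=
  HAtom.encode_injective.eq_iff

@[simp] theorem con_subst (σ : ℕ → HTerm K) (f : Sym K) : (con f : PTerm K).subst σ = con f := by
  simp [con, Term.subst]

@[simp] theorem pv_subst (σ : ℕ → HTerm K) (n : ℕ) : (pv n : PTerm K).subst σ = σ n := by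
  simp [pv, Term.subst]

@[simp] theorem FOTerm.toP_subst (σ : ℕ → HTerm K) (t : FOTerm K) :
    t.toP.subst σ = t.inst σ := by
  cases t
  · simp [FOTerm.toP, FOTerm.inst, con, Term.subst]
  · simp [FOTerm.toP, FOTerm.inst]

@[simp] theorem FOAtom.toP_subst (σ : ℕ → HTerm K) (a : FOAtom K) :
    a.toP.subst σ = (a.inst σ).encode := by
  simp [FOAtom.toP, FOAtom.inst, HAtom.encode, Term.subst, con, Function.comp_def]

@[simp] theorem FOAtom.toGoal_subst (σ : ℕ → HTerm K) (a : FOAtom K) :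
    a.toGoal.subst σ = (a.inst fun v => .app (.obs v) []).encode := by
  simp only [FOAtom.toGoal, FOAtom.inst, HAtom.encode, Term.subst, con, List.map_cons,
    List.map_map, List.map_nil, Term.app.injEq, List.cons.injEq, true_and]
  refine List.map_congr_left fun t _ => ?_
  cases t <;> simp [FOTerm.inst, Term.subst]

@[simp] theorem generalAtom_subst (σ : ℕ → HTerm K) (k o : ℕ) :
    (generalAtom k o : PTerm K).subst σ =
      .app .c (σ 0 :: (List.range k).map fun j => σ (o + j + 1)) := by
  simp [generalAtom, Term.subst, Function.comp_def]

theorem mem_varsOf {ts : List (FOTerm K)} {v : ℕ} : v ∈ varsOf ts ↔ FOTerm.var v ∈ ts := by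
  simp only [varsOf, List.mem_filterMap]
  constructor
  · rintro ⟨t, ht, h⟩
    cases t <;> simp_all
  · intro h
    exact ⟨_, h, rfl⟩

theorem FOAtom.inst_eq_inst {a : FOAtom K} {σ τ : ℕ → HTerm K} :
    a.inst σ = a.inst τ ↔ ∀ v ∈ varsOf a.args, σ v = τ v := by
  simp only [FOAtom.inst, HAtom.mk.injEq, true_and, List.map_inj_left, mem_varsOf]
  constructor
  · intro h v hv
    simpa [FOTerm.inst] using h _ hv
  · intro h t ht
    cases t with
    | cst k => rfl
    | var v => exact h v ht

theorem HornClause.mem_exVars {r : HornClause K} {v : ℕ} :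
    v ∈ r.exVars ↔ (∃ p ∈ r.body, v ∈ varsOf p.args) ∧ v ∉ r.headVars := by
  simp [HornClause.exVars]

namespace AbductionInstance

variable (A : AbductionInstance K)

/-- The head of clause `i` under a substitution. -/
def headAtom (i : Fin A.B.length) (σ : ℕ → HTerm K) : HAtom K := (A.B.get i).head.inst σ

variable {A}

theorem headAtom_congr {i : Fin A.B.length} {σ τ : ℕ → HTerm K} :
    A.headAtom i σ = A.headAtom i τ ↔ ∀ v ∈ (A.B.get i).headVars, σ v = τ v :=
  FOAtom.inst_eq_inst

theorem skolemSubst_of_mem {i : Fin A.B.length} {σ : ℕ → HTerm K} {v : ℕ}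
    (hv : v ∈ (A.B.get i).headVars) : A.skolemSubst i σ v = σ v := if_pos hv

theorem headAtom_skolemSubst (i : Fin A.B.length) (σ : ℕ → HTerm K) :
    A.headAtom i (A.skolemSubst i σ) = A.headAtom i σ :=
  headAtom_congr.2 fun _ hv => skolemSubst_of_mem hv

/-- Skolem terms mention only the values of the head variables. Hence the body atoms of a
back-chaining are determined by the atom and the clause, whichever matching substitution is taken.
-/
theorem skolemSubst_congr {i : Fin A.B.length} {σ τ : ℕ → HTerm K}
    (h : A.headAtom i σ = A.headAtom i τ) : A.skolemSubst i σ = A.skolemSubst i τ := by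
  rw [headAtom_congr] at h
  funext v
  unfold skolemSubst
  split_ifs with hv
  · exact h v hv
  · rw [List.map_congr_left h]

end AbductionInstance

variable {A : AbductionInstance K}

theorem progBwda_isNormal : ∀ r ∈ progBwda A, r.head.IsNormal := by
  intro r hr
  simp only [progBwda, progBpt, progBos, progGp, progEq, progC, clauseRules, List.mem_append,
    List.mem_cons, List.not_mem_nil, or_false, List.mem_flatten, List.mem_mapIdx, List.mem_map,
    List.mem_flatMap] at hr
  have h1 : ∀ (p : Pd) (ts : List (PTerm K)) b, (nrule p ts b).head.IsNormal :=
    fun p ts b => le_rfl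
  have h2 : ∀ b, (constraint b : PRule K).head.IsNormal := fun b => Nat.zero_le _
  rcases hr with (((((⟨_, ⟨i, hi, rfl⟩, hr⟩ | ⟨o, ho, rfl⟩) | ⟨k, hk, rfl⟩) | rfl | rfl) |
    rfl | rfl | rfl | rfl) | ⟨k, hk, j, hj, rfl⟩ | rfl | rfl | rfl | rfl | rfl) |
    ⟨k, hk, rfl⟩ | rfl | rfl | rfl | rfl | rfl
  · simp only [List.mem_cons, List.mem_map] at hr
    rcases hr with rfl | ⟨p, hp, rfl⟩ <;> exact h1 _ _ _
  all_goals first | exact h1 _ _ _ | exact h2 _ | trivial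

/-- The body equations of the `mayInferVia` rule pin each existential variable to its Skolem term.
-/
theorem clauseRules_mayInferVia {i : Fin A.B.length} {σ : ℕ → HTerm K}
    (h : ∀ j (hj : j < (A.B.get i).exVars.length), σ ((A.B.get i).exVars[j]) =
      .app .s (con (.clause i) :: .num (j + 1) :: (A.B.get i).headVars.map σ)) :
    ∀ v ∈ (A.B.get i).exVars, σ v = A.skolemSubst i σ v := by
  intro v hv
  have hj := List.idxOf_lt_length_of_mem hv
  have := h _ hj
  rw [List.getElem_idxOf hj] at this
  rw [this, AbductionInstance.skolemSubst, if_neg (HornClause.mem_exVars.1 hv).2, con]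

/-! ### The encoding as a one-step derivation relation -/

variable [LinearOrder (HTerm K)] (A)

/-- The ground atom `p(ts)`. -/
abbrev gat (p : Pd) (ts : List (HTerm K)) : GroundAtom Pd (Sym K) := ⟨p, ts⟩

/-- One-step derivations of the encoding from `J`, in the reduct with respect to `I`. -/
inductive Step (I J : Interpretation Pd (Sym K)) : GroundAtom Pd (Sym K) → Prop
  | goal {P : HAtom K} (h : P ∈ A.goals) : Step I J (gat .goal [P.encode])
  | sortname {t : HTerm K} (h : t ∈ A.sorts) : Step I J (gat .sortname [t])
  | mayInferVia (i : Fin A.B.length) (σ : ℕ → HTerm K)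
      (h : gat .pot [(A.headAtom i σ).encode] ∈ J) :
      Step I J (gat .mayInferVia [con (.clause i), (A.headAtom i σ).encode,
        .app .l ((A.B.get i).exVars.map (A.skolemSubst i σ))])
  | inferenceNeeds (i : Fin A.B.length) (σ : ℕ → HTerm K) {p : FOAtom K}
      (hp : p ∈ (A.B.get i).body)
      (h : gat .mayInferVia [con (.clause i), (A.headAtom i σ).encode,
        .app .l ((A.B.get i).exVars.map σ)] ∈ J) :
      Step I J (gat .inferenceNeeds [(A.headAtom i σ).encode, con (.clause i), (p.inst σ).encode])
  | pot_goal {x : HTerm K} (h : gat .goal [x] ∈ J) : Step I J (gat .pot [x])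
  | pot_needs {x y z : HTerm K} (h : gat .inferenceNeeds [x, y, z] ∈ J) : Step I J (gat .pot [z])
  | tru_goal {x : HTerm K} (h : gat .goal [x] ∈ J) : Step I J (gat .tru [x])
  | infer {x : HTerm K} (h : gat .tru [x] ∈ J) (hI : gat .infer [x] ∈ I) :
      Step I J (gat .infer [x])
  | fai {x : HTerm K} (h : gat .tru [x] ∈ J) (hI : gat .fai [x] ∈ I) :
      Step I J (gat .fai [x])
  | inferVia {x y z : HTerm K} (h : gat .infer [x] ∈ J) (hm : gat .mayInferVia [y, x, z] ∈ J)
      (hI : gat .inferVia [y, x] ∈ I) : Step I J (gat .inferVia [y, x])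
  | tru_needs {x y z : HTerm K} (h : gat .inferVia [y, x] ∈ J)
      (h' : gat .inferenceNeeds [x, y, z] ∈ J) : Step I J (gat .tru [z])
  | hu {p t : HTerm K} {ts : List (HTerm K)} (hk : ts.length ∈ A.arities)
      (h : gat .pot [.app .c (p :: ts)] ∈ J) (ht : t ∈ ts) : Step I J (gat .hu [t])
  | uhu {t : HTerm K} (h : gat .hu [t] ∈ J) (hs : gat .sortname [t] ∉ I) :
      Step I J (gat .uhu [t])
  | eq_choice {x y : HTerm K} (hx : gat .uhu [x] ∈ J) (hy : gat .uhu [y] ∈ J) (hne : x ≠ y)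
      (hI : gat .eq [x, y] ∈ I) : Step I J (gat .eq [x, y])
  | eq_refl {x : HTerm K} (hx : gat .hu [x] ∈ J) : Step I J (gat .eq [x, x])
  | factorCluster {p : HTerm K} {xs ys : List (HTerm K)} (hk : xs.length ∈ A.arities)
      (hx : gat .fa [.app .c (p :: xs)] ∈ J) (hy : gat .fa [.app .c (p :: ys)] ∈ J)
      (hlt : (.app .c (p :: xs) : HTerm K) < .app .c (p :: ys))
      (he : List.Forall₂ (fun x y => gat .eq [x, y] ∈ J) xs ys) :
      Step I J (gat .factorCluster [.app .c (p :: ys), .app .c (p :: xs)])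
  | factorClusterAbove {x y : HTerm K} (h : gat .factorCluster [x, y] ∈ J) :
      Step I J (gat .factorClusterAbove [x])
  | factorVia {x y : HTerm K} (h : gat .factorCluster [x, y] ∈ J)
      (hI : gat .factorClusterAbove [y] ∉ I) : Step I J (gat .factorVia [x, y])
  | factor {x y : HTerm K} (h : gat .factorVia [x, y] ∈ J) : Step I J (gat .factor [x])
  | abduce {x : HTerm K} (h : gat .fa [x] ∈ J) (hI : gat .factor [x] ∉ I) :
      Step I J (gat .abduce [x])
  | fa {x : HTerm K} (h : gat .fai [x] ∈ J) : Step I J (gat .fa [x])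

variable {A}

theorem step_of_derives {I J : Interpretation Pd (Sym K)} {a : GroundAtom Pd (Sym K)}
    (h : Derives (progBwda A) I J a) : Step A I J a := by
  obtain ⟨r, hr, σ, hbI, hbJ, hy⟩ := h
  simp only [progBwda, progBpt, progBos, progGp, progEq, progC, clauseRules, List.mem_append,
    List.mem_cons, List.not_mem_nil, or_false, List.mem_flatten, List.mem_mapIdx, List.mem_map,
    List.mem_flatMap] at hr
  rcases hr with (((((⟨_, ⟨i, hi, rfl⟩, hr⟩ | ⟨o, ho, rfl⟩) | ⟨k, hk, rfl⟩) | rfl | rfl) |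
    rfl | rfl | rfl | rfl) | ⟨k, hk, j, hj, rfl⟩ | rfl | rfl | rfl | rfl | rfl) |
    ⟨k, hk, rfl⟩ | rfl | rfl | rfl | rfl | rfl
  · simp only [List.mem_cons, List.mem_map] at hr
    rcases hr with rfl | ⟨p, hp, rfl⟩
    · simp only [nrule, BodyHolds, lit, List.mem_cons, List.mem_mapIdx, forall_eq_or_imp,
        Literal.Holds, Atom.subst, List.map_cons, FOAtom.toP_subst, List.map_nil,
        forall_exists_index, Head.Yields, List.not_mem_nil, or_false, exists_eq_left,
        con_subst] at hbI hbJ hy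
      subst hy
      have := clauseRules_mayInferVia (A := A) (i := ⟨i, hi⟩) (σ := σ) fun j hj => by
        simpa [Literal.Holds, Term.subst, Function.comp_def] using hbJ.2 _ j hj rfl
      have h := Step.mayInferVia (A := A) (I := I) ⟨i, hi⟩ σ hbJ.1
      rw [← List.map_congr_left this] at h
      simpa [Term.subst, Function.comp_def, AbductionInstance.headAtom] using h
    · simp [nrule, Head.Yields, BodyHolds, lit, Literal.Holds, Atom.subst, Term.subst,
        Function.comp_def] at hbI hbJ hy
      subst hy
      exact Step.inferenceNeeds ⟨i, hi⟩ σ hp hbJ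
  all_goals simp [nrule, constraint, Head.Yields, BodyHolds, lit, nlit, Literal.Holds, Atom.subst,
    ChoiceElem.Instance] at hbI hbJ hy
  · subst hy
    exact .goal ⟨o, ho, rfl⟩
  · subst hy
    exact .sortname ⟨k, hk, rfl⟩
  · exact hy ▸ .pot_goal hbJ
  · exact hy ▸ .pot_needs hbJ
  · exact hy ▸ .tru_goal hbJ
  · rcases hy with ⟨τ, hτ, rfl, hI⟩ | ⟨τ, hτ, rfl, hI⟩ <;> rw [hτ] at hI ⊢
    · exact .infer hbJ hI
    · exact .fai hbJ hI
  · obtain ⟨τ, hτ, -, hJ, rfl, hI⟩ := hy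
    rw [hτ 0 (by simp) (by simp)] at hI hJ ⊢
    exact .inferVia hbJ hJ hI
  · exact hy ▸ .tru_needs hbJ.1 hbJ.2
  · subst hy
    exact .hu (by simpa using hk) hbJ (List.mem_map.2 ⟨j, hj, rfl⟩)
  · exact hy ▸ .uhu hbJ.1 hbI.2
  · obtain ⟨τ, -, -, hJ, rfl, hI⟩ := hy
    exact .eq_choice hJ.1 hJ.2.1 hJ.2.2 hI
  · exact hy ▸ .eq_refl hbJ
  · subst hy
    refine .factorCluster (by simpa using hk) hbJ.1 hbJ.2.1 hbJ.2.2.1 ?_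
    simpa [List.forall₂_map_left_iff, List.forall₂_map_right_iff, List.forall₂_same]
      using hbJ.2.2.2
  · exact hy ▸ .factorClusterAbove hbJ
  · exact hy ▸ .factorVia hbJ.1 hbI.2
  · exact hy ▸ .factor hbJ
  · exact hy ▸ .abduce hbJ.1 hbI.2
  · exact hy ▸ .fa hbJ

theorem derives_nrule {I J : Interpretation Pd (Sym K)} {p : Pd} {ts : List (PTerm K)}
    {ts' : List (HTerm K)} {b : List (Literal Pd (Sym K) ℕ)} (hr : nrule p ts b ∈ progBwda A)
    (σ : ℕ → HTerm K) (ht : ts.map (Term.subst σ) = ts')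
    (hb : ∀ l ∈ b, l.Holds σ I ∧ l.Holds σ J) :
    Derives (progBwda A) I J (gat p ts') :=
  ⟨_, hr, σ, fun l hl => (hb l hl).1, fun l hl => (hb l hl).2, _, List.mem_singleton_self _,
    by subst ht; rfl⟩

/-- Serves to instantiate the rules with a variable number of arguments: rule variable `n` receives
the `n`-th entry of one long list, and the argument block of `generalAtom` reads off a segment of
it. -/
theorem map_range_getD {α : Type*} (xs ys zs : List α) (d : α) :
    (List.range ys.length).map (fun j => (xs ++ (ys ++ zs)).getD (xs.length + j) d) = ys := by
  refine List.ext_getElem (by simp) fun n h1 h2 => ?_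
  simp [List.getElem?_append, h2]

/-- `Derives` wants bodies true in both `I` and `J`, while `Step` checks positive literals in `J`
and negative ones in `I`. The inclusion `J ⊆ I` transfers each to the other set. -/
theorem Step.derives {I J : Interpretation Pd (Sym K)} {a : GroundAtom Pd (Sym K)} (hJI : J ⊆ I)
    (h : Step A I J a) : Derives (progBwda A) I J a := by
  have hI : ∀ {a}, a ∈ J → a ∈ I := fun h => hJI h
  have hJ : ∀ {a}, a ∉ I → a ∉ J := fun h h' => h (hJI h')
  have mem1 : ∀ r ∈ progGp (K := K), r ∈ progBwda A := fun r hr => by simp [progBwda, hr]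
  have mem2 : ∀ r ∈ progEq A, r ∈ progBwda A := fun r hr => by simp [progBwda, hr]
  have mem3 : ∀ r ∈ progC A, r ∈ progBwda A := fun r hr => by simp [progBwda, hr]
  have mem4 : ∀ r ∈ progBpt A, r ∈ progBwda A := fun r hr => by simp [progBwda, hr]
  have memC : ∀ (i : Fin A.B.length), ∀ r ∈ clauseRules i (A.B.get i), r ∈ progBwda A :=
    fun i r hr => mem4 r (by
      simp only [progBpt, progBos, List.mem_append, List.mem_flatten, List.mem_mapIdx]
      exact .inl (.inl (.inl ⟨_, ⟨i, i.2, rfl⟩, hr⟩)))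
  cases h with
  | goal h =>
    obtain ⟨o, ho, rfl⟩ := h
    exact derives_nrule (ts := [o.toGoal]) (b := [])
      (mem4 _ (by simp [progBpt, progBos]; exact .inr (.inl ⟨o, ho, rfl⟩)))
      (fun _ => .num 0) (by simp) (by simp)
  | sortname h =>
    obtain ⟨k, hk, rfl⟩ := h
    exact derives_nrule (ts := [con (.name k)]) (b := [])
      (mem4 _ (by simp [progBpt, progBos]; exact .inr (.inr (.inl ⟨k, hk, rfl⟩))))
      (fun _ => .num 0) (by simp [con, Term.subst]) (by simp)
  | mayInferVia i σ h =>
    -- The rule is instantiated with the Skolem substitution instead of `σ`, so that the equations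
    -- in its body hold; the head atom is the same under both.
    refine derives_nrule (memC i _ (List.mem_cons_self ..)) (A.skolemSubst i σ) ?_ ?_
    · rw [← AbductionInstance.headAtom_skolemSubst i σ]
      simp [Term.subst, Function.comp_def, AbductionInstance.headAtom]
    · rw [← AbductionInstance.headAtom_skolemSubst i σ] at h
      simp only [List.mem_cons, List.mem_mapIdx, forall_eq_or_imp]
      refine ⟨⟨by simpa [lit, Literal.Holds, Atom.subst, AbductionInstance.headAtom] using hI h,
        by simpa [lit, Literal.Holds, Atom.subst, AbductionInstance.headAtom] using h⟩, ?_⟩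
      rintro _ ⟨j, hj, rfl⟩
      have h1 : (A.B.get i).exVars[j] ∉ (A.B.get i).headVars :=
        (HornClause.mem_exVars.1 (List.getElem_mem hj)).2
      -- Since `exVars` has no repetitions, the variable at position `j` has index `j`, which
      -- matches the number `j + 1` in its Skolem term.
      have h2 : (A.B.get i).exVars.idxOf (A.B.get i).exVars[j] = j :=
        (List.nodup_dedup _).idxOf_getElem j hj
      have h3 : (A.B.get i).headVars.map (A.skolemSubst i σ) = (A.B.get i).headVars.map σ :=
        List.map_congr_left fun v hv => AbductionInstance.skolemSubst_of_mem hv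
      simp only [Literal.Holds, Term.subst, pv_subst, List.map_cons, con_subst, List.map_map,
        Function.comp_def, and_self, h3]
      rw [AbductionInstance.skolemSubst, if_neg h1, h2]
      rfl
  | inferenceNeeds i σ hp h =>
    refine derives_nrule (memC i _ (List.mem_cons_of_mem _ (List.mem_map.2 ⟨_, hp, rfl⟩))) σ ?_ ?_
    · simp [AbductionInstance.headAtom]
    · simpa [lit, Literal.Holds, Atom.subst, Term.subst, Function.comp_def] using ⟨hI h, h⟩
  | @pot_goal x h =>
    exact derives_nrule (mem4 (nrule .pot [pv 0] [lit .goal [pv 0]]) (by simp [progBpt]))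
      (fun _ => x) (by simp) (by simp [lit, Literal.Holds, Atom.subst, h, hI h])
  | @pot_needs x y z h =>
    -- Rule variables `0`, `1`, `2` take the listed values; the default of `getD` is only used for
    -- variables absent from the rule.
    exact derives_nrule (mem4 (nrule .pot [pv 2] [lit .inferenceNeeds [pv 0, pv 1, pv 2]])
      (by simp [progBpt])) (fun n => [x, y, z].getD n x) (by simp)
      (by simp [lit, Literal.Holds, Atom.subst, h, hI h])
  | @tru_goal x h =>
    exact derives_nrule (mem1 (nrule .tru [pv 0] [lit .goal [pv 0]]) (by simp [progGp]))
      (fun _ => x) (by simp) (by simp [lit, Literal.Holds, Atom.subst, h, hI h])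
  | @infer x h hI' =>
    refine ⟨⟨.choice 1 1 [⟨⟨.infer, [pv 0]⟩, [], []⟩, ⟨⟨.fai, [pv 0]⟩, [], []⟩],
      [lit .tru [pv 0]]⟩, mem1 _ (by simp [progGp]), fun _ => x, ?_, ?_, ?_⟩
    · simp [BodyHolds, lit, Literal.Holds, Atom.subst, hI h]
    · simp [BodyHolds, lit, Literal.Holds, Atom.subst, h]
    · exact ⟨⟨⟨.infer, [pv 0]⟩, [], []⟩, by simp, fun _ => x, fun _ _ => rfl, by simp [BodyHolds],
        by simp [BodyHolds], by simp [Atom.subst], hI'⟩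
  | @fai x h hI' =>
    refine ⟨⟨.choice 1 1 [⟨⟨.infer, [pv 0]⟩, [], []⟩, ⟨⟨.fai, [pv 0]⟩, [], []⟩],
      [lit .tru [pv 0]]⟩, mem1 _ (by simp [progGp]), fun _ => x, ?_, ?_, ?_⟩
    · simp [BodyHolds, lit, Literal.Holds, Atom.subst, hI h]
    · simp [BodyHolds, lit, Literal.Holds, Atom.subst, h]
    · exact ⟨⟨⟨.fai, [pv 0]⟩, [], []⟩, by simp, fun _ => x, fun _ _ => rfl, by simp [BodyHolds],
        by simp [BodyHolds], by simp [Atom.subst], hI'⟩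
  | @inferVia x y z h hm hI' =>
    refine ⟨⟨.choice 1 1 [⟨⟨.inferVia, [pv 1, pv 0]⟩, [lit .mayInferVia [pv 1, pv 0, pv 2]],
      [1, 2]⟩], [lit .infer [pv 0]]⟩, mem1 _ (by simp [progGp]), fun _ => x, ?_, ?_, ?_⟩
    · simp [BodyHolds, lit, Literal.Holds, Atom.subst, hI h]
    · simp [BodyHolds, lit, Literal.Holds, Atom.subst, h]
    · refine ⟨_, List.mem_singleton_self _, fun n => if n = 1 then y else if n = 2 then z else x,
        ?_, ?_, ?_, ?_, hI'⟩
      · intro v hv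
        simp only [List.mem_cons, List.not_mem_nil, or_false, not_or] at hv
        simp [hv]
      · simp [BodyHolds, lit, Literal.Holds, Atom.subst, hI hm]
      · simp [BodyHolds, lit, Literal.Holds, Atom.subst, hm]
      · simp [Atom.subst]
  | @tru_needs x y z h h' =>
    exact derives_nrule (mem1 (nrule .tru [pv 2] [lit .inferVia [pv 1, pv 0],
      lit .inferenceNeeds [pv 0, pv 1, pv 2]]) (by simp [progGp])) (fun n => [x, y, z].getD n x)
      (by simp) (by simp [lit, Literal.Holds, Atom.subst, h, hI h, h', hI h'])
  | @hu p t ts hk h ht =>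
    obtain ⟨j, hj, rfl⟩ := List.getElem_of_mem ht
    have hm : nrule .hu [pv (j + 1)] [lit .pot [generalAtom ts.length 0]] ∈ progBwda A :=
      mem2 _ (List.mem_append_left _ (List.mem_flatMap.2 ⟨_, hk, List.mem_map.2
        ⟨j, List.mem_range.2 hj, rfl⟩⟩))
    have h1 := map_range_getD [p] ts [] p
    simp only [List.append_nil, List.length_singleton, List.singleton_append, Nat.add_comm 1] at h1
    refine derives_nrule hm (fun n => (p :: ts).getD n p) (by simp [hj]) ?_
    simp only [lit, Literal.Holds, Atom.subst, List.mem_singleton, forall_eq, List.map_cons,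
      List.map_nil, generalAtom_subst, Nat.zero_add, h1]
    exact ⟨hI h, h⟩
  | @uhu x h hs =>
    exact derives_nrule (mem2 (nrule .uhu [pv 0] [lit .hu [pv 0], nlit .sortname [pv 0]])
      (by simp [progEq])) (fun _ => x) (by simp)
      (by simp [lit, nlit, Literal.Holds, Atom.subst, h, hI h, hs, hJ hs])
  | @eq_choice x y hx hy hne hI' =>
    refine ⟨⟨.choice 0 ⊤ [⟨⟨.eq, [pv 0, pv 1]⟩, [lit .uhu [pv 0], lit .uhu [pv 1],
      .ne (pv 0) (pv 1)], [0, 1]⟩], []⟩, mem2 _ (by simp [progEq]), fun _ => x, ?_, ?_, ?_⟩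
    · simp [BodyHolds]
    · simp [BodyHolds]
    · refine ⟨_, List.mem_singleton_self _, fun n => if n = 1 then y else x,
        ?_, ?_, ?_, ?_, hI'⟩
      · intro v hv
        simp only [List.mem_cons, List.not_mem_nil, or_false, not_or] at hv
        simp [hv]
      · simp [BodyHolds, lit, Literal.Holds, Atom.subst, hI hx, hI hy, hne]
      · simp [BodyHolds, lit, Literal.Holds, Atom.subst, hx, hy, hne]
      · simp [Atom.subst]
  | @eq_refl x h =>
    exact derives_nrule (mem2 (nrule .eq [pv 0, pv 0] [lit .hu [pv 0]]) (by simp [progEq]))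
      (fun _ => x) (by simp) (by simp [lit, Literal.Holds, Atom.subst, h, hI h])
  | @factorCluster p xs ys hk hx hy hlt he =>
    have hl := he.length_eq
    have hm := mem3 _ (List.mem_append_left _ (List.mem_map.2 ⟨_, hk, rfl⟩))
    have h1 := map_range_getD [p] xs ys p
    have h2 := map_range_getD (p :: xs) ys [] p
    simp only [List.append_nil, List.cons_append, List.nil_append, List.length_nil, Nat.zero_add,
      List.length_cons, ← hl, Nat.add_right_comm _ 1] at h1 h2
    -- Variable `0` is the predicate, `1, …, k` are the arguments `xs` of the smaller atom and `k +
    -- 1, …, 2k` the arguments `ys` of the larger one.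
    refine derives_nrule hm (fun n => (p :: (xs ++ ys)).getD n p) ?_ ?_
    · simp only [List.map_cons, generalAtom_subst, Nat.zero_add, List.map_nil, h1, h2,
        List.getD_cons_zero]
    · have hlit : ∀ M : Interpretation Pd (Sym K),
          List.Forall₂ (fun x y => gat .eq [x, y] ∈ M) xs ys → ∀ j < xs.length,
          gat .eq [(p :: (xs ++ ys)).getD (j + 1) p,
            (p :: (xs ++ ys)).getD (xs.length + j + 1) p] ∈ M := by
        intro M hM j hj
        have := hM.get hj (hl ▸ hj)
        simpa [List.getElem?_append, hj, hl ▸ hj] using this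
      simp only [List.mem_cons, forall_eq_or_imp, lit, Literal.Holds, Atom.subst, List.map_cons,
        List.map_nil, generalAtom_subst, Nat.zero_add, h1, h2, List.getD_cons_zero, List.mem_map,
        List.mem_range, forall_exists_index, and_imp, forall_apply_eq_imp_iff₂, pv_subst]
      exact ⟨⟨hI hx, hx⟩, ⟨hI hy, hy⟩, ⟨hlt, hlt⟩, fun j hj =>
        ⟨hlit I (he.imp fun _ _ h => hI h) j hj, hlit J he j hj⟩⟩
  | @factorClusterAbove x y h =>
    exact derives_nrule (mem3 (nrule .factorClusterAbove [pv 0] [lit .factorCluster [pv 0, pv 1]])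
      (by simp [progC])) (fun n => [x, y].getD n x) (by simp)
      (by simp [lit, Literal.Holds, Atom.subst, h, hI h])
  | @factorVia x y h hs =>
    exact derives_nrule (mem3 (nrule .factorVia [pv 0, pv 1] [lit .factorCluster [pv 0, pv 1],
      nlit .factorClusterAbove [pv 1]]) (by simp [progC])) (fun n => [x, y].getD n x) (by simp)
      (by simp [lit, nlit, Literal.Holds, Atom.subst, h, hI h, hs, hJ hs])
  | @factor x y h =>
    exact derives_nrule (mem3 (nrule .factor [pv 0] [lit .factorVia [pv 0, pv 1]])
      (by simp [progC])) (fun n => [x, y].getD n x) (by simp)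
      (by simp [lit, Literal.Holds, Atom.subst, h, hI h])
  | @abduce x h hs =>
    exact derives_nrule (mem3 (nrule .abduce [pv 0] [lit .fa [pv 0], nlit .factor [pv 0]])
      (by simp [progC])) (fun _ => x) (by simp)
      (by simp [lit, nlit, Literal.Holds, Atom.subst, h, hI h, hs, hJ hs])
  | @fa x h =>
    exact derives_nrule (mem3 (nrule .fa [pv 0] [lit .fai [pv 0]]) (by simp [progC]))
      (fun _ => x) (by simp) (by simp [lit, Literal.Holds, Atom.subst, h, hI h])

end Abduction

namespace Abduction

open ASP

variable {K : Type u} {A : AbductionInstance K}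

/-! ### The represented graphs -/

namespace AbductionInstance

/-- The atoms that are reachable from the observation by the back-chainings in `V`. -/
inductive Derived (A : AbductionInstance K) (V : Set (Fin A.B.length × HAtom K)) :
    HAtom K → Prop
  | goal {P : HAtom K} (h : P ∈ A.goals) : Derived A V P
  | body {P Q : HAtom K} {i : Fin A.B.length} (hP : Derived A V P) (hV : (i, P) ∈ V)
      (hQ : Q ∈ A.bodyAtoms i P) : Derived A V Q

variable (A) in
/-- The nodes of the potential proof graph. -/
abbrev Potential : HAtom K → Prop := A.Derived Set.univ

theorem Derived.mono {V W : Set (Fin A.B.length × HAtom K)} (h : V ⊆ W) {P : HAtom K}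
    (hP : A.Derived V P) : A.Derived W P := by
  induction hP with
  | goal h => exact .goal h
  | body _ hV hQ ih => exact .body ih (h hV) hQ

theorem Derived.potential {V : Set (Fin A.B.length × HAtom K)} {P : HAtom K}
    (hP : A.Derived V P) : A.Potential P :=
  hP.mono (Set.subset_univ _)

theorem applicable_of_mem_bodyAtoms {i : Fin A.B.length} {P Q : HAtom K}
    (h : Q ∈ A.bodyAtoms i P) : A.Applicable i P :=
  ⟨h.choose, h.choose_spec.1⟩

theorem mem_bodyAtoms_headAtom {i : Fin A.B.length} {σ : ℕ → HTerm K} {p : FOAtom K}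
    (hp : p ∈ (A.B.get i).body) : p.inst (A.skolemSubst i σ) ∈ A.bodyAtoms i (A.headAtom i σ) :=
  ⟨σ, rfl, p, hp, rfl⟩

theorem IsHypothesis.potential {H : Hypothesis K} (hH : A.IsHypothesis H) :
    ∀ P ∈ H.atoms, A.Potential P := by
  induction hH with
  | observation => exact fun P hP => .goal hP
  | backchain _ hP _ ih =>
    rintro Q (hQ | hQ)
    · exact ih Q hQ
    · exact .body (ih _ hP) trivial hQ
  | unify _ _ _ _ _ ih => exact ih

theorem Derived.exists_hypothesis {V : Set (Fin A.B.length × HAtom K)} {P : HAtom K}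
    (hP : A.Derived V P) : ∃ H ∈ A.hypotheses, P ∈ H.atoms := by
  induction hP with
  | goal h => exact ⟨_, .observation, h⟩
  | body _ _ hQ ih =>
    obtain ⟨H, hH, hP⟩ := ih
    exact ⟨_, .backchain hH hP (applicable_of_mem_bodyAtoms hQ), .inr hQ⟩

/-- Hypotheses contain only potential atoms, and each potential atom is reached by some hypothesis;
so the Herbrand universe is what the program collects in `hu`. -/
theorem mem_herbrandTerms {t : HTerm K} :
    t ∈ A.herbrandTerms ↔ ∃ P, A.Potential P ∧ t ∈ P.args := by
  constructor
  · rintro ⟨H, hH, P, hP, ht⟩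
    exact ⟨P, IsHypothesis.potential hH P hP, ht⟩
  · rintro ⟨P, hP, ht⟩
    obtain ⟨H, hH, hP⟩ := hP.exists_hypothesis
    exact ⟨H, hH, P, hP, ht⟩

/-- Needed because the rules for `hu` and `factorCluster` exist only for arities that occur in `A`.
-/
theorem Derived.length_mem_arities {V : Set (Fin A.B.length × HAtom K)} {P : HAtom K}
    (hP : A.Derived V P) : P.args.length ∈ A.arities := by
  simp only [arities, List.mem_dedup, List.mem_map, List.mem_append, List.mem_flatMap,
    List.mem_cons]
  cases hP with
  | goal h =>
    obtain ⟨o, ho, rfl⟩ := h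
    exact ⟨o, .inl ho, by simp [FOAtom.inst]⟩
  | @body _ _ i _ _ hQ =>
    obtain ⟨σ, -, p, hp, rfl⟩ := hQ
    exact ⟨p, .inr ⟨_, A.B.get_mem i, .inr hp⟩, by simp [FOAtom.inst]⟩

end AbductionInstance

variable (V : Set (Fin A.B.length × HAtom K)) (E : Set (HTerm K × HTerm K))

/-- The derived atoms that are not back-chained. -/
def IsFa (P : HAtom K) : Prop := A.Derived V P ∧ ∀ i, (i, P) ∉ V

section Order

variable [LinearOrder (HTerm K)]

/-- `Q` can be factored with the smaller atom `P`. -/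
def IsCluster (Q P : HAtom K) : Prop :=
  IsFa V P ∧ IsFa V Q ∧ P.encode < Q.encode ∧ UnifyUnder E P Q

/-- `Q` is factored with the least atom `P` of its cluster. -/
def IsFac (Q P : HAtom K) : Prop := IsCluster V E Q P ∧ ∀ R, ¬ IsCluster V E P R

/-- The extensions of the predicates in the answer set that represents `V` and `E`. -/
def extension : Pd → List (HTerm K) → Prop
  | .goal, ts => ∃ P ∈ A.goals, ts = [P.encode]
  | .sortname, ts => ∃ t ∈ A.sorts, ts = [t]
  | .pot, ts => ∃ P, A.Potential P ∧ ts = [P.encode]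
  | .hu, ts => ∃ t ∈ A.herbrandTerms, ts = [t]
  | .uhu, ts => ∃ t ∈ A.herbrandTerms, t ∉ A.sorts ∧ ts = [t]
  | .eq, ts => ∃ x y, (x, y) ∈ E ∧ ts = [x, y]
  | .mayInferVia, ts => ∃ i σ, A.Potential (A.headAtom i σ) ∧
      ts = [con (.clause i), (A.headAtom i σ).encode,
        .app .l ((A.B.get i).exVars.map (A.skolemSubst i σ))]
  | .inferenceNeeds, ts => ∃ i P Q, A.Potential P ∧ Q ∈ A.bodyAtoms i P ∧
      ts = [P.encode, con (.clause i), Q.encode]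
  | .tru, ts => ∃ P, A.Derived V P ∧ ts = [P.encode]
  | .infer, ts => ∃ i P, (i, P) ∈ V ∧ ts = [P.encode]
  | .fai, ts => ∃ P, IsFa V P ∧ ts = [P.encode]
  | .inferVia, ts => ∃ i P, (i, P) ∈ V ∧ ts = [con (.clause i), P.encode]
  | .fa, ts => ∃ P, IsFa V P ∧ ts = [P.encode]
  | .factorCluster, ts => ∃ Q P, IsCluster V E Q P ∧ ts = [Q.encode, P.encode]
  | .factorClusterAbove, ts => ∃ Q P, IsCluster V E Q P ∧ ts = [Q.encode]
  | .factorVia, ts => ∃ Q P, IsFac V E Q P ∧ ts = [Q.encode, P.encode]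
  | .factor, ts => ∃ Q P, IsFac V E Q P ∧ ts = [Q.encode]
  | .abduce, ts => ∃ P, IsFa V P ∧ (∀ R, ¬ IsFac V E P R) ∧ ts = [P.encode]

/-- The answer set that represents `V` and `E`. -/
def interp : Interpretation Pd (Sym K) := {a | extension V E a.pred a.args}

end Order

/-- The conditions under which `V` and `E` are represented by an answer set. -/
structure IsAdmissible : Prop where
  derived : ∀ i P, (i, P) ∈ V → A.Derived V P
  applicable : ∀ i P, (i, P) ∈ V → A.Applicable i P
  unique : ∀ i j P, (i, P) ∈ V → (j, P) ∈ V → i = j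
  termEquiv : IsTermEquivalence A E

variable {V E}

/-! ### Models of the encoding -/

/-- The constraints and the bounds of the choices of the encoding. -/
structure MeetsBounds (I : Interpretation Pd (Sym K)) : Prop where
  infer_or_fai : ∀ x, gat .tru [x] ∈ I → Xor (gat .infer [x] ∈ I) (gat .fai [x] ∈ I)
  inferVia : ∀ x, gat .infer [x] ∈ I →
    ∃! y, gat .inferVia [y, x] ∈ I ∧ ∃ z, gat .mayInferVia [y, x, z] ∈ I
  eq_symm : ∀ x y, gat .eq [x, y] ∈ I → gat .eq [y, x] ∈ I
  eq_trans : ∀ x y z, gat .eq [x, y] ∈ I → gat .eq [y, z] ∈ I → x ≠ y → y ≠ z → x ≠ z →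
    gat .eq [x, z] ∈ I

variable [LinearOrder (HTerm K)]

omit A in
theorem selected_infer_fai (I : Interpretation Pd (Sym K)) (σ : ℕ → HTerm K) :
    selected σ I [⟨⟨.infer, [pv 0]⟩, [], []⟩, ⟨⟨.fai, [pv 0]⟩, [], []⟩] =
      {a | a ∈ I ∧ (a = gat .infer [σ 0] ∨ a = gat .fai [σ 0])} := by
  ext a
  simp only [selected, ChoiceElem.Instance, BodyHolds, List.mem_cons, List.not_mem_nil, or_false,
    exists_eq_or_imp, exists_eq_left, Atom.subst, List.map_cons, List.map_nil, pv_subst,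
    Set.mem_ofPred_eq, not_false_eq_true, forall_true_left, IsEmpty.forall_iff, implies_true,
    true_and]
  constructor
  · rintro ⟨ha, ⟨τ, hτ, rfl⟩ | ⟨τ, hτ, rfl⟩⟩ <;> simp_all
  · rintro ⟨ha, rfl | rfl⟩
    · exact ⟨ha, .inl ⟨σ, fun _ => rfl, rfl⟩⟩
    · exact ⟨ha, .inr ⟨σ, fun _ => rfl, rfl⟩⟩

omit A in
-- The third argument of `mayInferVia` is local to the condition, so selected atoms are counted by
-- clause identifiers alone.
theorem selected_inferVia (I : Interpretation Pd (Sym K)) (σ : ℕ → HTerm K) :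
    selected σ I [⟨⟨.inferVia, [pv 1, pv 0]⟩, [lit .mayInferVia [pv 1, pv 0, pv 2]], [1, 2]⟩] =
      (fun y => gat .inferVia [y, σ 0]) ''
        {y | gat .inferVia [y, σ 0] ∈ I ∧ ∃ z, gat .mayInferVia [y, σ 0, z] ∈ I} := by
  ext a
  simp only [selected, ChoiceElem.Instance, BodyHolds, List.mem_cons, List.not_mem_nil, or_false,
    exists_eq_left, Atom.subst, List.map_cons, List.map_nil, pv_subst, not_or, and_imp,
    Set.mem_ofPred_eq, forall_eq, lit, Literal.Holds, Set.mem_image]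
  constructor
  · rintro ⟨ha, τ, hτ, hm, rfl⟩
    rw [hτ 0 (by simp) (by simp)] at *
    exact ⟨τ 1, ⟨ha, τ 2, hm⟩, rfl⟩
  · rintro ⟨y, ⟨ha, z, hz⟩, rfl⟩
    exact ⟨ha, fun n => if n = 1 then y else if n = 2 then z else σ n, by simp +contextual,
      by simpa using hz, by simp⟩

omit A in
theorem encard_bounds {α : Type*} (s : Set α) :
    (1 ≤ s.encard ∧ s.encard ≤ 1) ↔ ∃! a, a ∈ s := by
  rw [and_comm, ← le_antisymm_iff, Set.encard_eq_one]
  constructor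
  · rintro ⟨a, rfl⟩
    exact ⟨a, rfl, fun b hb => hb⟩
  · rintro ⟨a, ha, h⟩
    exact ⟨a, Set.eq_singleton_iff_unique_mem.2 ⟨ha, h⟩⟩

theorem admissible_iff_meetsBounds (A : AbductionInstance K) (I : Interpretation Pd (Sym K)) :
    (∀ r ∈ progBwda A, ∀ σ, BodyHolds σ I r.body → r.head.Admissible σ I) ↔ MeetsBounds I := by
  have e1 : ∀ σ : ℕ → HTerm K, (1 ≤ (selected σ I [⟨⟨.infer, [pv 0]⟩, [], []⟩,
      ⟨⟨.fai, [pv 0]⟩, [], []⟩]).encard ∧ (selected σ I [⟨⟨.infer, [pv 0]⟩, [], []⟩,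
      ⟨⟨.fai, [pv 0]⟩, [], []⟩]).encard ≤ 1) ↔
      Xor (gat .infer [σ 0] ∈ I) (gat .fai [σ 0] ∈ I) := by
    intro σ
    rw [encard_bounds, selected_infer_fai]
    constructor
    · rintro ⟨a, ⟨ha, rfl | rfl⟩, hu⟩
      · exact .inl ⟨ha, fun h => by simpa using hu _ ⟨h, .inr rfl⟩⟩
      · exact .inr ⟨ha, fun h => by simpa using hu _ ⟨h, .inl rfl⟩⟩
    · rintro (⟨h, h'⟩ | ⟨h, h'⟩)
      · refine ⟨_, ⟨h, .inl rfl⟩, ?_⟩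
        rintro b ⟨hb, rfl | rfl⟩
        exacts [rfl, absurd hb h']
      · refine ⟨_, ⟨h, .inr rfl⟩, ?_⟩
        rintro b ⟨hb, rfl | rfl⟩
        exacts [absurd hb h', rfl]
  have e2 : ∀ σ : ℕ → HTerm K, (1 ≤ (selected σ I [⟨⟨.inferVia, [pv 1, pv 0]⟩,
      [lit .mayInferVia [pv 1, pv 0, pv 2]], [1, 2]⟩]).encard ∧ (selected σ I
      [⟨⟨.inferVia, [pv 1, pv 0]⟩, [lit .mayInferVia [pv 1, pv 0, pv 2]], [1, 2]⟩]).encard ≤ 1) ↔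
      ∃! y, gat .inferVia [y, σ 0] ∈ I ∧ ∃ z, gat .mayInferVia [y, σ 0, z] ∈ I := by
    intro σ
    rw [selected_inferVia, Function.Injective.encard_image (fun x y h => by simpa using h),
      encard_bounds]
    rfl
  constructor
  · intro h
    have mem1 : ∀ r ∈ progGp (K := K), r ∈ progBwda A := fun r hr => by simp [progBwda, hr]
    have mem2 : ∀ r ∈ progEq A, r ∈ progBwda A := fun r hr => by simp [progBwda, hr]
    refine ⟨fun x hx => ?_, fun x hx => ?_, fun x y hxy => ?_, fun x y z hxy hyz h1 h2 h3 => ?_⟩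
    · exact (e1 fun _ => x).1 (h _ (mem1 _ (List.mem_cons_of_mem _ (List.mem_cons_self ..)))
        (fun _ => x) (by simpa [BodyHolds, lit, Literal.Holds, Atom.subst] using hx))
    · exact (e2 fun _ => x).1 (h _ (mem1 _ (List.mem_cons_of_mem _ (List.mem_cons_of_mem _
        (List.mem_cons_self ..)))) (fun _ => x)
        (by simpa [BodyHolds, lit, Literal.Holds, Atom.subst] using hx))
    · by_contra hn
      exact h (constraint [lit .eq [pv 0, pv 1], nlit .eq [pv 1, pv 0]])
        (mem2 _ (by simp [progEq])) (fun n => [x, y].getD n x)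
        (by simp [constraint, BodyHolds, lit, nlit, Literal.Holds, Atom.subst, hxy, hn]) rfl
    · by_contra hn
      exact h (constraint [lit .eq [pv 0, pv 1], lit .eq [pv 1, pv 2], .ne (pv 0) (pv 1),
        .ne (pv 1) (pv 2), .ne (pv 0) (pv 2), nlit .eq [pv 0, pv 2]])
        (mem2 _ (by simp [progEq])) (fun n => [x, y, z].getD n x)
        (by simp [constraint, BodyHolds, lit, nlit, Literal.Holds, Atom.subst, hxy, hyz, hn, h1,
          h2, h3]) rfl
  · intro h r hr σ hb
    simp only [progBwda, progBpt, progBos, progGp, progEq, progC, clauseRules, List.mem_append,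
      List.mem_cons, List.not_mem_nil, or_false, List.mem_flatten, List.mem_mapIdx, List.mem_map,
      List.mem_flatMap] at hr
    have h1 : ∀ (p : Pd) (ts : List (PTerm K)) b, (nrule p ts b).head.Admissible σ I :=
      fun p ts b => List.cons_ne_nil _ _
    rcases hr with (((((⟨_, ⟨i, hi, rfl⟩, hr⟩ | ⟨o, ho, rfl⟩) | ⟨k, hk, rfl⟩) | rfl | rfl) |
      rfl | rfl | rfl | rfl) | ⟨k, hk, j, hj, rfl⟩ | rfl | rfl | rfl | rfl | rfl) |
      ⟨k, hk, rfl⟩ | rfl | rfl | rfl | rfl | rfl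
    · simp only [List.mem_cons, List.mem_map] at hr
      rcases hr with rfl | ⟨p, hp, rfl⟩ <;> exact h1 _ _ _
    all_goals try exact h1 _ _ _
    · exact (e1 σ).2 (h.infer_or_fai _
        (by simpa [BodyHolds, lit, Literal.Holds, Atom.subst] using hb))
    · exact (e2 σ).2 (h.inferVia _
        (by simpa [BodyHolds, lit, Literal.Holds, Atom.subst] using hb))
    · exact ⟨zero_le, le_top⟩
    · simp only [constraint, BodyHolds, lit, nlit, List.mem_cons, List.not_mem_nil, or_false,
        forall_eq_or_imp, Literal.Holds, Atom.subst, List.map_cons, pv_subst, List.map_nil,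
        forall_eq] at hb
      exact absurd (h.eq_symm _ _ hb.1) hb.2
    · simp only [constraint, BodyHolds, lit, nlit, List.mem_cons, List.not_mem_nil, or_false,
        forall_eq_or_imp, Literal.Holds, Atom.subst, List.map_cons, pv_subst, List.map_nil,
        forall_eq] at hb
      exact absurd (h.eq_trans _ _ _ hb.1 hb.2.1 hb.2.2.1 hb.2.2.2.1 hb.2.2.2.2.1) hb.2.2.2.2.2

/-- The form of the semantics used from here on: programs, substitutions and literals no longer
appear. -/
theorem isAnswerSet_iff (A : AbductionInstance K) (I : Interpretation Pd (Sym K)) :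
    IsAnswerSet (progBwda A) I ↔ (∀ a, Step A I I a → a ∈ I) ∧ MeetsBounds I ∧
      ∀ J ⊆ I, (∀ a, Step A I J a → a ∈ J) → J = I := by
  have e : ∀ J ⊆ I, (∀ a, Derives (progBwda A) I J a → a ∈ J) ↔ ∀ a, Step A I J a → a ∈ J :=
    fun J hJ => ⟨fun h a ha => h a (ha.derives hJ), fun h a ha => h a (step_of_derives ha)⟩
  have e' : IsModel (progBwda A) I ↔ (∀ a, Step A I I a → a ∈ I) ∧ MeetsBounds I := by
    rw [isModel_iff progBwda_isNormal, admissible_iff_meetsBounds, e I subset_rfl]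
  rw [← and_assoc, ← e', IsAnswerSet, and_congr_right_iff]
  intro hI
  refine forall₂_congr fun J hJ => ?_
  rw [hI.isReductModel_iff progBwda_isNormal, e J hJ]

end Abduction

namespace Abduction

open ASP AbductionInstance

variable {K : Type u} {A : AbductionInstance K}
  {V : Set (Fin A.B.length × HAtom K)} {E : Set (HTerm K × HTerm K)}

@[simp] theorem con_inj {f g : Sym K} : (con f : HTerm K) = con g ↔ f = g := by
  simp [con]

theorem HAtom.eq_of_app_eq_encode {P : HAtom K} {p : HTerm K} {ts : List (HTerm K)}
    (h : (.app .c (p :: ts) : HTerm K) = P.encode) :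
    p = con (.name P.pred) ∧ ts = P.args := by
  simpa [HAtom.encode, con] using h

variable [LinearOrder (HTerm K)]

theorem mem_interp {p : Pd} {ts : List (HTerm K)} :
    gat p ts ∈ interp V E ↔ extension V E p ts := Iff.rfl

/-- The rule for `inferenceNeeds` has its own substitution `σ`. The head atom fixes `σ` on head
variables and the list `l(Z₁,…,Zᵥ)` fixes it on the existential ones; every body variable is of one
of these kinds, so the body instance is the Skolemised one. -/
theorem inferenceNeeds_of_mayInferVia {i : Fin A.B.length} {σ : ℕ → HTerm K} {p : FOAtom K}
    (hp : p ∈ (A.B.get i).body) (h : extension V E .mayInferVia [con (.clause i),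
      (A.headAtom i σ).encode, .app .l ((A.B.get i).exVars.map σ)]) :
    extension V E .inferenceNeeds
      [(A.headAtom i σ).encode, con (.clause i), (p.inst σ).encode] := by
  obtain ⟨j, τ, hP, he⟩ := h
  simp only [List.cons.injEq, con_inj, Sym.clause.injEq, Fin.val_inj, HAtom.encode_inj,
    Term.app.injEq, and_true, true_and] at he
  obtain ⟨rfl, hh, hx⟩ := he
  refine ⟨i, _, _, hh ▸ hP, ⟨τ, hh.symm, _, hp, rfl⟩, ?_⟩
  simp only [List.cons.injEq, HAtom.encode_inj, and_true, true_and]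
  rw [FOAtom.inst_eq_inst]
  intro v hv
  by_cases hvh : v ∈ (A.B.get i).headVars
  · rw [skolemSubst_of_mem hvh]
    exact headAtom_congr.1 hh v hvh
  · exact List.map_inj_left.1 hx v (HornClause.mem_exVars.2 ⟨⟨_, hp, hv⟩, hvh⟩)

/-! ### Closed sets contain the represented atoms -/

section Closed

variable {I J : Interpretation Pd (Sym K)} (hJ : ∀ a, Step A I J a → a ∈ J)

include hJ

theorem pot_mem_of_closed {P : HAtom K} (hP : A.Potential P) : gat .pot [P.encode] ∈ J := by
  induction hP with
  | goal h => exact hJ _ (.pot_goal (hJ _ (.goal h)))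
  | body _ _ hQ ih =>
    obtain ⟨σ, rfl, p, hp, rfl⟩ := hQ
    have h := hJ _ (.mayInferVia _ σ ih)
    -- Now the head atom and the list of Skolem terms are instances under one substitution, as the
    -- rule for `inferenceNeeds` requires.
    rw [← headAtom_skolemSubst] at h
    exact hJ _ (.pot_needs (hJ _ (.inferenceNeeds _ _ hp h)))

theorem mayInferVia_mem_of_closed {i : Fin A.B.length} {σ : ℕ → HTerm K}
    (h : A.Potential (A.headAtom i σ)) :
    gat .mayInferVia [con (.clause i), (A.headAtom i σ).encode,
        .app .l ((A.B.get i).exVars.map (A.skolemSubst i σ))] ∈ J :=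
  hJ _ (.mayInferVia _ _ (pot_mem_of_closed hJ h))

theorem inferenceNeeds_mem_of_closed {i : Fin A.B.length} {P Q : HAtom K}
    (h : A.Potential P) (hQ : Q ∈ A.bodyAtoms i P) :
    gat .inferenceNeeds [P.encode, con (.clause i), Q.encode] ∈ J := by
  obtain ⟨σ, rfl, p, hp, rfl⟩ := hQ
  have h := mayInferVia_mem_of_closed hJ (σ := σ) h
  rw [← headAtom_skolemSubst] at h
  have := hJ _ (.inferenceNeeds _ _ hp h)
  rwa [headAtom_skolemSubst] at this

theorem hu_mem_of_closed {t : HTerm K} (h : t ∈ A.herbrandTerms) : gat .hu [t] ∈ J := by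
  obtain ⟨P, hP, ht⟩ := mem_herbrandTerms.1 h
  exact hJ _ (.hu hP.length_mem_arities (pot_mem_of_closed hJ hP) ht)

theorem uhu_mem_of_closed (hs : ∀ t, gat .sortname [t] ∈ I → t ∈ A.sorts) {t : HTerm K}
    (h : t ∈ A.herbrandTerms) (ht : t ∉ A.sorts) : gat .uhu [t] ∈ J :=
  hJ _ (.uhu (hu_mem_of_closed hJ h) fun h => ht (hs _ h))

/-- Reflexive pairs are derived from `hu`. A pair of distinct terms involves no sort name, because
sort classes are singletons, so it is available to the choice rule. -/
theorem eq_mem_of_closed (hs : ∀ t, gat .sortname [t] ∈ I → t ∈ A.sorts)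
    (hE : IsTermEquivalence A E) (hI : ∀ x y, (x, y) ∈ E → gat .eq [x, y] ∈ I) {x y : HTerm K}
    (h : (x, y) ∈ E) : gat .eq [x, y] ∈ J := by
  have hm := hE.mem_terms _ _ h
  by_cases hne : x = y
  · subst hne
    exact hJ _ (.eq_refl (hu_mem_of_closed hJ hm.1))
  · exact hJ _ (.eq_choice
      (uhu_mem_of_closed hJ hs hm.1 fun hx => hne (hE.sort_singleton _ _ h hx).symm)
      (uhu_mem_of_closed hJ hs hm.2 fun hy => hne (hE.sort_singleton _ _ (hE.symm _ _ h) hy))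
      hne (hI _ _ h))

/-- A closed set contains the derived atoms and their back-chainings if these are chosen in `I`. -/
theorem inferVia_tru_mem_of_closed
    (hI : ∀ i P, (i, P) ∈ V → A.Applicable i P ∧ gat .infer [P.encode] ∈ I ∧
      gat .inferVia [con (.clause i), P.encode] ∈ I) {P : HAtom K} (hP : A.Derived V P) :
    gat .tru [P.encode] ∈ J ∧ ∀ i, (i, P) ∈ V → gat .infer [P.encode] ∈ J ∧
      gat .inferVia [con (.clause i), P.encode] ∈ J := by
  have key : ∀ {P}, A.Derived V P → gat .tru [P.encode] ∈ J → ∀ i, (i, P) ∈ V →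
      gat .infer [P.encode] ∈ J ∧ gat .inferVia [con (.clause i), P.encode] ∈ J := by
    intro P hP ht i hi
    obtain ⟨⟨σ, rfl⟩, h1, h2⟩ := hI i P hi
    have h := hJ _ (.infer ht h1)
    exact ⟨h, hJ _ (.inferVia h (mayInferVia_mem_of_closed hJ hP.potential) h2)⟩
  suffices h : gat .tru [P.encode] ∈ J from ⟨h, key hP h⟩
  induction hP with
  | goal h => exact hJ _ (.tru_goal (hJ _ (.goal h)))
  | body hP hV hQ ih =>
    exact hJ _ (.tru_needs (key hP ih _ hV).2 (inferenceNeeds_mem_of_closed hJ hP.potential hQ))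

theorem factorCluster_mem_of_closed
    (hf : ∀ P, IsFa V P → gat .fai [P.encode] ∈ J)
    (hE : ∀ x y, (x, y) ∈ E → gat .eq [x, y] ∈ J) {Q P : HAtom K} (h : IsCluster V E Q P) :
    gat .factorCluster [Q.encode, P.encode] ∈ J := by
  obtain ⟨hP, hQ, hlt, hp, hu⟩ := h
  have hP' := hJ _ (.fa (hf _ hP))
  have hQ' := hJ _ (.fa (hf _ hQ))
  have := hP.1.length_mem_arities
  rcases P with ⟨p, xs⟩
  rcases Q with ⟨q, ys⟩
  obtain rfl : p = q := hp
  exact hJ _ (.factorCluster this hP' hQ' hlt (hu.imp fun _ _ h => hE _ _ h))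

end Closed

/-! ### The represented interpretations are answer sets -/

omit [LinearOrder (HTerm K)] in
theorem unifyUnder_trans (hE : IsTermEquivalence A E) {P Q R : HAtom K} (h : UnifyUnder E P Q)
    (h' : UnifyUnder E Q R) : UnifyUnder E P R := by
  refine ⟨h.1.trans h'.1, List.forall₂_iff_get.2
    ⟨h.2.length_eq.trans h'.2.length_eq, fun i h1 h2 => ?_⟩⟩
  have h3 := h.2.length_eq ▸ h1
  exact hE.trans _ _ _ (h.2.get h1 h3) (h'.2.get h3 h2)

omit [LinearOrder (HTerm K)] in
theorem unifyUnder_symm (hE : IsTermEquivalence A E) {P Q : HAtom K} (h : UnifyUnder E P Q) :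
    UnifyUnder E Q P :=
  ⟨h.1.symm, h.2.flip.imp fun _ _ h => hE.symm _ _ h⟩

/-- Choice atoms lie in `interp V E` by being selected there. Admissibility enters only for `true`
atoms obtained by back-chaining and for reflexivity of `eq`. -/
theorem interp_step (h : IsAdmissible V E) {a : GroundAtom Pd (Sym K)}
    (ha : Step A (interp V E) (interp V E) a) : a ∈ interp V E := by
  cases ha with
  | goal h => exact ⟨_, h, rfl⟩
  | sortname h => exact ⟨_, h, rfl⟩
  | mayInferVia i σ h =>
    obtain ⟨P, hP, he⟩ := h
    simp at he
    exact ⟨i, σ, he ▸ hP, rfl⟩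
  | inferenceNeeds i σ hp h =>
    exact inferenceNeeds_of_mayInferVia (V := V) (E := E) hp h
  | pot_goal h =>
    obtain ⟨P, hP, he⟩ := h
    exact ⟨P, .goal hP, he⟩
  | pot_needs h =>
    obtain ⟨i, P, Q, hP, hQ, he⟩ := h
    simp only [List.cons.injEq, and_true] at he
    exact ⟨Q, .body hP trivial hQ, by simp [he]⟩
  | tru_goal h =>
    obtain ⟨P, hP, he⟩ := h
    exact ⟨P, .goal hP, he⟩
  | infer _ hI => exact hI
  | fai _ hI => exact hI
  | inferVia _ _ hI => exact hI
  | tru_needs hv hn =>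
    obtain ⟨i, P, hP, he⟩ := hv
    obtain ⟨j, P', Q, hP', hQ, he'⟩ := hn
    simp only [List.cons.injEq, and_true] at he he'
    obtain ⟨rfl, rfl⟩ := he
    simp only [HAtom.encode_inj, con_inj, Sym.clause.injEq, Fin.val_inj] at he'
    obtain ⟨rfl, rfl, rfl⟩ := he'
    exact ⟨Q, .body (h.derived _ _ hP) hP hQ, rfl⟩
  | hu hk h ht =>
    obtain ⟨P, hP, he⟩ := h
    simp only [List.cons.injEq, and_true] at he
    obtain ⟨rfl, rfl⟩ := HAtom.eq_of_app_eq_encode he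
    exact ⟨_, mem_herbrandTerms.2 ⟨P, hP, ht⟩, rfl⟩
  | uhu h hs =>
    obtain ⟨t, ht, he⟩ := h
    obtain rfl : _ = t := by simpa using he
    exact ⟨_, ht, fun h => hs ⟨_, h, rfl⟩, rfl⟩
  | eq_choice _ _ _ hI => exact hI
  | eq_refl hx =>
    obtain ⟨t, ht, he⟩ := hx
    obtain rfl : _ = t := by simpa using he
    exact ⟨_, _, h.termEquiv.refl _ ht, rfl⟩
  | factorCluster hk hx hy hlt he =>
    obtain ⟨P, hP, hp⟩ := hx
    obtain ⟨Q, hQ, hq⟩ := hy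
    simp only [List.cons.injEq, and_true] at hp hq
    refine ⟨Q, P, ⟨hP, hQ, hp ▸ hq ▸ hlt, ?_⟩, by rw [hp, hq]⟩
    obtain ⟨rfl, rfl⟩ := HAtom.eq_of_app_eq_encode hp
    obtain ⟨h1, rfl⟩ := HAtom.eq_of_app_eq_encode hq
    refine ⟨by simpa using h1, he.imp ?_⟩
    rintro x y ⟨x', y', hxy, he⟩
    simp only [List.cons.injEq, and_true] at he
    rwa [he.1, he.2]
  | factorClusterAbove h =>
    obtain ⟨Q, P, h, he⟩ := h
    simp only [List.cons.injEq, and_true] at he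
    exact ⟨Q, P, h, by simp [he]⟩
  | factorVia h hI =>
    obtain ⟨Q, P, h, he⟩ := h
    simp only [List.cons.injEq, and_true] at he
    exact ⟨Q, P, ⟨h, fun R hR => hI ⟨P, R, hR, by simp [he]⟩⟩, by simp [he]⟩
  | factor h =>
    obtain ⟨Q, P, h, he⟩ := h
    simp only [List.cons.injEq, and_true] at he
    exact ⟨Q, P, h, by simp [he]⟩
  | abduce h hI =>
    obtain ⟨P, h, he⟩ := h
    simp only [List.cons.injEq, and_true] at he
    exact ⟨P, h, fun R hR => hI ⟨P, R, hR, by simp [he]⟩, by simp [he]⟩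
  | fa h => exact h

theorem interp_meetsBounds (h : IsAdmissible V E) : MeetsBounds (interp V E) := by
  refine ⟨?_, ?_, ?_, ?_⟩
  · rintro x ⟨P, hP, he⟩
    obtain rfl : x = _ := by simpa using he
    by_cases hi : ∃ i, (i, P) ∈ V
    · refine .inl ⟨⟨_, P, hi.choose_spec, rfl⟩, ?_⟩
      rintro ⟨P', hP', he⟩
      obtain rfl : P = P' := by simpa using he
      exact hP'.2 _ hi.choose_spec
    · refine .inr ⟨⟨P, ⟨hP, fun i h => hi ⟨i, h⟩⟩, rfl⟩, ?_⟩
      rintro ⟨i, P', hP', he⟩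
      obtain rfl : P = P' := by simpa using he
      exact hi ⟨i, hP'⟩
  · rintro x ⟨i, P, hP, he⟩
    obtain rfl : x = _ := by simpa using he
    refine ⟨con (.clause i), ⟨⟨i, P, hP, rfl⟩, ?_⟩, ?_⟩
    · obtain ⟨σ, rfl⟩ := h.applicable _ _ hP
      exact ⟨_, i, σ, (h.derived _ _ hP).potential, rfl⟩
    · rintro y ⟨⟨j, P', hP', he⟩, -⟩
      simp only [List.cons.injEq, HAtom.encode_inj, and_true] at he
      obtain ⟨rfl, rfl⟩ := he
      rw [h.unique _ _ _ hP hP']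
  · rintro x y ⟨x', y', hxy, he⟩
    simp only [List.cons.injEq, and_true] at he
    obtain ⟨rfl, rfl⟩ := he
    exact ⟨_, _, h.termEquiv.symm _ _ hxy, rfl⟩
  · rintro x y z ⟨x', y', hxy, he⟩ ⟨y'', z', hyz, he'⟩ - - -
    simp only [List.cons.injEq, and_true] at he he'
    obtain ⟨rfl, rfl⟩ := he
    obtain ⟨rfl, rfl⟩ := he'
    exact ⟨_, _, h.termEquiv.trans _ _ _ hxy hyz, rfl⟩

/-- A closed set contains the represented interpretation if the chosen and the negated atoms
of the reduct are the represented ones. -/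
theorem interp_subset_of_closed (h : IsAdmissible V E) {I J : Interpretation Pd (Sym K)}
    (hJ : ∀ a, Step A I J a → a ∈ J)
    (hs : ∀ t, gat .sortname [t] ∈ I → t ∈ A.sorts)
    (hE : ∀ x y, (x, y) ∈ E → gat .eq [x, y] ∈ I)
    (hV : ∀ i P, (i, P) ∈ V → gat .infer [P.encode] ∈ I ∧
      gat .inferVia [con (.clause i), P.encode] ∈ I)
    (hf : ∀ P, IsFa V P → gat .tru [P.encode] ∈ J → gat .fai [P.encode] ∈ I)
    (ha : ∀ Q, gat .factorClusterAbove [Q.encode] ∈ I → ∃ P, IsCluster V E Q P)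
    (hfac : (∀ Q P, IsCluster V E Q P → gat .factorCluster [Q.encode, P.encode] ∈ J) →
      ∀ Q, gat .factor [Q.encode] ∈ I → ∃ P, IsFac V E Q P) :
    interp V E ⊆ J := by
  have hE' : ∀ x y, (x, y) ∈ E → gat .eq [x, y] ∈ J :=
    fun x y => eq_mem_of_closed hJ hs h.termEquiv hE
  have hT := fun P hP => inferVia_tru_mem_of_closed (P := P) hJ
    (fun i P hi => ⟨h.applicable i P hi, hV i P hi⟩) hP
  have hF : ∀ P, IsFa V P → gat .fai [P.encode] ∈ J := fun P hP =>
    hJ _ (.fai (hT P hP.1).1 (hf P hP (hT P hP.1).1))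
  have hC : ∀ Q P, IsCluster V E Q P → gat .factorCluster [Q.encode, P.encode] ∈ J :=
    fun Q P => factorCluster_mem_of_closed hJ hF hE'
  have hVia : ∀ Q P, IsFac V E Q P → gat .factorVia [Q.encode, P.encode] ∈ J :=
    fun Q P hQ => hJ _ (.factorVia (hC _ _ hQ.1) fun h' => (ha _ h').elim hQ.2)
  rintro ⟨p, ts⟩ hp
  cases p with
  | goal => obtain ⟨P, hP, rfl⟩ := hp; exact hJ _ (.goal hP)
  | sortname => obtain ⟨t, ht, rfl⟩ := hp; exact hJ _ (.sortname ht)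
  | pot => obtain ⟨P, hP, rfl⟩ := hp; exact pot_mem_of_closed hJ hP
  | hu => obtain ⟨t, ht, rfl⟩ := hp; exact hu_mem_of_closed hJ ht
  | uhu => obtain ⟨t, ht, hts, rfl⟩ := hp; exact uhu_mem_of_closed hJ hs ht hts
  | eq => obtain ⟨x, y, hxy, rfl⟩ := hp; exact hE' _ _ hxy
  | mayInferVia => obtain ⟨i, σ, hP, rfl⟩ := hp; exact mayInferVia_mem_of_closed hJ hP
  | inferenceNeeds =>
    obtain ⟨i, P, Q, hP, hQ, rfl⟩ := hp; exact inferenceNeeds_mem_of_closed hJ hP hQ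
  | tru => obtain ⟨P, hP, rfl⟩ := hp; exact (hT P hP).1
  | infer => obtain ⟨i, P, hP, rfl⟩ := hp; exact ((hT P (h.derived _ _ hP)).2 i hP).1
  | fai => obtain ⟨P, hP, rfl⟩ := hp; exact hF P hP
  | inferVia => obtain ⟨i, P, hP, rfl⟩ := hp; exact ((hT P (h.derived _ _ hP)).2 i hP).2
  | fa => obtain ⟨P, hP, rfl⟩ := hp; exact hJ _ (.fa (hF P hP))
  | factorCluster => obtain ⟨Q, P, hP, rfl⟩ := hp; exact hC _ _ hP
  | factorClusterAbove =>
    obtain ⟨Q, P, hP, rfl⟩ := hp; exact hJ _ (.factorClusterAbove (hC _ _ hP))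
  | factorVia => obtain ⟨Q, P, hP, rfl⟩ := hp; exact hVia _ _ hP
  | factor => obtain ⟨Q, P, hP, rfl⟩ := hp; exact hJ _ (.factor (hVia _ _ hP))
  | abduce =>
    obtain ⟨P, hP, hR, rfl⟩ := hp
    -- `hfac` may assume that `J` contains all clusters. For an answer set, this is what excludes a
    -- `factorVia` atom whose target has a smaller partner, so it cannot be settled before `hC`.
    exact hJ _ (.abduce (hJ _ (.fa (hF P hP))) fun h' => (hfac hC _ h').elim hR)

/-- A subset of `interp V E` closed in the reduct contains `interp V E`, since the choices and
negated atoms are then the represented ones. -/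
theorem IsAdmissible.isAnswerSet (h : IsAdmissible V E) :
    IsAnswerSet (progBwda A) (interp V E) := by
  refine (isAnswerSet_iff A _).2 ⟨fun a => interp_step h, interp_meetsBounds h,
    fun J hJI hJ => hJI.antisymm (interp_subset_of_closed h hJ ?_ ?_ ?_ ?_ ?_ ?_)⟩
  · rintro t ⟨t', ht, he⟩
    obtain rfl : t = t' := by simpa using he
    exact ht
  · exact fun x y hxy => ⟨x, y, hxy, rfl⟩
  · exact fun i P hP => ⟨⟨i, P, hP, rfl⟩, ⟨i, P, hP, rfl⟩⟩
  · exact fun P hP _ => ⟨P, hP, rfl⟩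
  · rintro Q ⟨Q', P, hP, he⟩
    obtain rfl : Q = Q' := by simpa using he
    exact ⟨P, hP⟩
  · rintro - Q ⟨Q', P, hP, he⟩
    obtain rfl : Q = Q' := by simpa using he
    exact ⟨P, hP⟩

/-! ### Answer sets are represented interpretations -/

/-- The back-chaining inferences of an interpretation. -/
def viaOf (A : AbductionInstance K) (I : Interpretation Pd (Sym K)) :
    Set (Fin A.B.length × HAtom K) :=
  {x | gat .inferVia [con (.clause x.1), x.2.encode] ∈ I}

/-- The equivalence relation of an interpretation. -/
def eqOf (I : Interpretation Pd (Sym K)) : Set (HTerm K × HTerm K) :=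
  {x | gat .eq [x.1, x.2] ∈ I}

/-- Invariants of the recursive predicates of an answer set. -/
def Founded (V : Set (Fin A.B.length × HAtom K)) : Pd → List (HTerm K) → Prop
  | .pot, ts => ∃ P, A.Potential P ∧ ts = [P.encode]
  | .mayInferVia, ts => ∃ i σ, A.Potential (A.headAtom i σ) ∧
      ts = [con (.clause i), (A.headAtom i σ).encode,
        .app .l ((A.B.get i).exVars.map (A.skolemSubst i σ))]
  | .inferenceNeeds, ts => ∃ i P Q, A.Potential P ∧ Q ∈ A.bodyAtoms i P ∧
      ts = [P.encode, con (.clause i), Q.encode]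
  | .tru, ts => ∃ P, A.Derived V P ∧ ts = [P.encode]
  | .infer, ts => ∃ P, A.Derived V P ∧ ts = [P.encode]
  | .inferVia, ts => ∃ y P, A.Derived V P ∧ ts = [y, P.encode]
  | _, _ => True

theorem Step.mono {I J J' : Interpretation Pd (Sym K)} (h : J ⊆ J')
    {a : GroundAtom Pd (Sym K)} (ha : Step A I J a) : Step A I J' a := by
  cases ha with
  | goal h' => exact .goal h'
  | sortname h' => exact .sortname h'
  | mayInferVia i σ h' => exact .mayInferVia i σ (h h')
  | inferenceNeeds i σ hp h' => exact .inferenceNeeds i σ hp (h h')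
  | pot_goal h' => exact .pot_goal (h h')
  | pot_needs h' => exact .pot_needs (h h')
  | tru_goal h' => exact .tru_goal (h h')
  | infer h' hI => exact .infer (h h') hI
  | fai h' hI => exact .fai (h h') hI
  | inferVia h' hm hI => exact .inferVia (h h') (h hm) hI
  | tru_needs h' hn => exact .tru_needs (h h') (h hn)
  | hu hk h' ht => exact .hu hk (h h') ht
  | uhu h' hs => exact .uhu (h h') hs
  | eq_choice hx hy hne hI => exact .eq_choice (h hx) (h hy) hne hI
  | eq_refl hx => exact .eq_refl (h hx)
  | factorCluster hk hx hy hlt he =>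
    exact .factorCluster hk (h hx) (h hy) hlt (he.imp fun _ _ h' => h h')
  | factorClusterAbove h' => exact .factorClusterAbove (h h')
  | factorVia h' hI => exact .factorVia (h h') hI
  | factor h' => exact .factor (h h')
  | abduce h' hI => exact .abduce (h h') hI
  | fa h' => exact .fa (h h')

/-- The atoms of `I` with property `p` form a closed set of the reduct, so by minimality they are
all of `I`. -/
theorem _root_.ASP.IsAnswerSet.induction {I : Interpretation Pd (Sym K)}
    (hI : IsAnswerSet (progBwda A) I) {p : GroundAtom Pd (Sym K) → Prop}
    (h : ∀ a, Step A I {b | b ∈ I ∧ p b} a → p a) : ∀ a ∈ I, p a := by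
  obtain ⟨h1, -, h2⟩ := (isAnswerSet_iff A I).1 hI
  have := h2 {b | b ∈ I ∧ p b} (fun b hb => hb.1)
    fun a ha => ⟨h1 a (ha.mono fun b hb => hb.1), h a ha⟩
  intro a ha
  rw [← this] at ha
  exact ha.2

theorem _root_.ASP.IsAnswerSet.supported {I : Interpretation Pd (Sym K)}
    (hI : IsAnswerSet (progBwda A) I) : ∀ a ∈ I, Step A I I a :=
  hI.induction fun _ ha => ha.mono fun _ hb => hb.1

/-- Support alone would allow atoms that justify each other in a circle; the induction principle
shows that `pot` and `true` atoms have derivations starting from the observation. -/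
theorem _root_.ASP.IsAnswerSet.founded {I : Interpretation Pd (Sym K)}
    (hI : IsAnswerSet (progBwda A) I) : ∀ a ∈ I, Founded (viaOf A I) a.pred a.args := by
  refine hI.induction fun a ha => ?_
  have hgoal : ∀ x, gat .goal [x] ∈ I → ∃ P ∈ A.goals, [x] = [P.encode] := by
    intro x hx
    cases hI.supported _ hx with
    | goal h => exact ⟨_, h, rfl⟩
  cases ha with
  | mayInferVia i σ h =>
    obtain ⟨P, hP, he⟩ := h.2
    simp at he
    exact ⟨i, σ, he ▸ hP, rfl⟩
  | inferenceNeeds i σ hp h =>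
    exact inferenceNeeds_of_mayInferVia (V := viaOf A I) (E := eqOf I) hp h.2
  | pot_goal h =>
    obtain ⟨P, hP, he⟩ := hgoal _ h.1
    exact ⟨P, .goal hP, he⟩
  | pot_needs h =>
    obtain ⟨i, P, Q, hP, hQ, he⟩ := h.2
    simp only [List.cons.injEq, and_true] at he
    exact ⟨Q, .body hP trivial hQ, by simp [he]⟩
  | tru_goal h =>
    obtain ⟨P, hP, he⟩ := hgoal _ h.1
    exact ⟨P, .goal hP, he⟩
  | infer h hI => exact h.2
  | inferVia h _ _ =>
    obtain ⟨P, hP, he⟩ := h.2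
    exact ⟨_, P, hP, by rw [List.cons.inj he |>.1]⟩
  | tru_needs hv hn =>
    obtain ⟨y, P, hP, he⟩ := hv.2
    obtain ⟨j, P', Q, hP', hQ, he'⟩ := hn.2
    have hv := hv.1
    simp only [List.cons.injEq, and_true] at he he'
    obtain ⟨rfl, rfl⟩ := he
    simp only [HAtom.encode_inj] at he'
    obtain ⟨rfl, rfl, rfl⟩ := he'
    exact ⟨Q, .body hP hv hQ, rfl⟩
  | _ => trivial

/-- Each atom of `I` has a supporting rule instance, which bounds every predicate from above by its
extension in `interp`; the reverse inclusion holds because `I` is closed. Because of the negated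
`factorClusterAbove`, the bounds on `factorVia` and `factor` need that all clusters are already in
`I`. -/
theorem _root_.ASP.IsAnswerSet.eq_interp {I : Interpretation Pd (Sym K)}
    (hI : IsAnswerSet (progBwda A) I) :
    IsAdmissible (viaOf A I) (eqOf I) ∧ I = interp (viaOf A I) (eqOf I) := by
  obtain ⟨hcl, hb, -⟩ := (isAnswerSet_iff A I).1 hI
  have hsup := hI.supported
  have hfd := hI.founded
  have hsort : ∀ t, gat .sortname [t] ∈ I → t ∈ A.sorts := by
    intro x hx
    cases hsup _ hx with
    | sortname h => exact h
  have hhu : ∀ t, gat .hu [t] ∈ I → t ∈ A.herbrandTerms := by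
    intro t ht
    cases hsup _ ht with
    | hu hk h ht =>
      obtain ⟨P, hP, he⟩ := hfd _ h
      simp only [List.cons.injEq, and_true] at he
      obtain ⟨rfl, rfl⟩ := HAtom.eq_of_app_eq_encode he
      exact mem_herbrandTerms.2 ⟨P, hP, ht⟩
  have huhu : ∀ t, gat .uhu [t] ∈ I → t ∈ A.herbrandTerms ∧ t ∉ A.sorts := by
    intro t ht
    cases hsup _ ht with
    | uhu h hs => exact ⟨hhu _ h, fun h => hs (hcl _ (.sortname h))⟩
  have heq : ∀ x y, gat .eq [x, y] ∈ I → x ∈ A.herbrandTerms ∧ y ∈ A.herbrandTerms ∧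
      (x ∈ A.sorts → y = x) := by
    intro x y h
    cases hsup _ h with
    | eq_choice hx hy _ _ => exact ⟨(huhu _ hx).1, (huhu _ hy).1, fun h => absurd h (huhu _ hx).2⟩
    | eq_refl hx => exact ⟨hhu _ hx, hhu _ hx, fun _ => rfl⟩
  have hvia : ∀ x y, gat .inferVia [y, x] ∈ I → gat .infer [x] ∈ I ∧
      ∃ i P, A.Derived (viaOf A I) P ∧ A.Applicable i P ∧ y = con (.clause i) ∧ x = P.encode ∧
        ∃ z, gat .mayInferVia [y, x, z] ∈ I := by
    intro x y h
    cases hsup _ h with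
    | inferVia hx hm hI =>
      refine ⟨hx, ?_⟩
      obtain ⟨P, hP, he⟩ := hfd _ hx
      obtain ⟨i, σ, hP', he'⟩ := hfd _ hm
      simp only [List.cons.injEq, and_true] at he he'
      obtain ⟨rfl, hh, -⟩ := he'
      subst he
      simp only [HAtom.encode_inj] at hh
      exact ⟨i, P, hP, ⟨σ, hh.symm⟩, rfl, rfl, _, hm⟩
  have hadm : IsAdmissible (viaOf A I) (eqOf I) := by
    refine ⟨fun i P h => ?_, fun i P h => ?_, fun i j P h h' => ?_, ?_⟩
    · obtain ⟨-, -, P', hP, -, -, he, -⟩ := hvia _ _ h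
      rwa [← HAtom.encode_inj.1 he] at hP
    · obtain ⟨-, j, P', -, hP, he', he, -⟩ := hvia _ _ h
      obtain rfl : i = j := by simpa [Fin.val_inj] using he'
      rwa [← HAtom.encode_inj.1 he] at hP
    · obtain ⟨hx, -, -, -, -, -, -, hz⟩ := hvia _ _ h
      obtain ⟨-, -, -, -, -, -, -, hz'⟩ := hvia _ _ h'
      simpa [Fin.val_inj] using (hb.inferVia _ hx).unique ⟨h, hz⟩ ⟨h', hz'⟩
    · refine ⟨fun x y h => ⟨(heq _ _ h).1, (heq _ _ h).2.1⟩,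
        fun x hx => hcl _ (.eq_refl (hu_mem_of_closed hcl hx)), hb.eq_symm, fun x y z h h' => ?_,
        fun x y h => (heq _ _ h).2.2⟩
      -- The transitivity constraint speaks of three distinct terms only; when `x = z`, the
      -- reflexive pair has to come from `hu`.
      by_cases h1 : x = y
      · exact h1 ▸ h'
      by_cases h2 : y = z
      · exact h2 ▸ h
      by_cases h3 : x = z
      · subst h3
        exact hcl _ (.eq_refl (hu_mem_of_closed hcl (heq _ _ h).1))
      · exact hb.eq_trans _ _ _ h h' h1 h2 h3
  refine ⟨hadm, ?_⟩
  have hinfer : ∀ x, gat .infer [x] ∈ I → ∃ i P, (i, P) ∈ viaOf A I ∧ x = P.encode := by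
    intro x hx
    obtain ⟨y, ⟨hy, -⟩, -⟩ := hb.inferVia _ hx
    obtain ⟨-, i, P, -, -, rfl, rfl, -⟩ := hvia _ _ hy
    exact ⟨i, P, hy, rfl⟩
  have hfai : ∀ x, gat .fai [x] ∈ I → ∃ P, IsFa (viaOf A I) P ∧ x = P.encode := by
    intro x hx
    cases hsup _ hx with
    | fai ht _ =>
      obtain ⟨P, hP, he⟩ := hfd _ ht
      obtain rfl : x = _ := by simpa using he
      refine ⟨P, ⟨hP, fun i hi => ?_⟩, rfl⟩
      have := (hvia _ _ hi).1
      rcases hb.infer_or_fai _ ht with h | h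
      · exact h.2 hx
      · exact h.2 this
  have hfa : ∀ x, gat .fa [x] ∈ I → ∃ P, IsFa (viaOf A I) P ∧ x = P.encode := by
    intro x hx
    cases hsup _ hx with
    | fa h => exact hfai _ h
  have hclu : ∀ x y, gat .factorCluster [x, y] ∈ I → ∃ Q P,
      IsCluster (viaOf A I) (eqOf I) Q P ∧ x = Q.encode ∧ y = P.encode := by
    intro x y h
    cases hsup _ h with
    | factorCluster hk hx hy hlt he =>
      obtain ⟨P, hP, hp⟩ := hfa _ hx
      obtain ⟨Q, hQ, hq⟩ := hfa _ hy
      refine ⟨Q, P, ⟨hP, hQ, hp ▸ hq ▸ hlt, ?_⟩, hq, hp⟩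
      obtain ⟨rfl, rfl⟩ := HAtom.eq_of_app_eq_encode hp
      obtain ⟨h1, rfl⟩ := HAtom.eq_of_app_eq_encode hq
      exact ⟨by simpa using h1, he⟩
  have habove : ∀ x, gat .factorClusterAbove [x] ∈ I → ∃ Q P,
      IsCluster (viaOf A I) (eqOf I) Q P ∧ x = Q.encode := by
    intro x h
    cases hsup _ h with
    | factorClusterAbove h =>
      obtain ⟨Q, P, h, he, -⟩ := hclu _ _ h
      exact ⟨Q, P, h, he⟩
  have hfacVia : (∀ Q P, IsCluster (viaOf A I) (eqOf I) Q P →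
      gat .factorCluster [Q.encode, P.encode] ∈ I) → ∀ x y, gat .factorVia [x, y] ∈ I →
      ∃ Q P, IsFac (viaOf A I) (eqOf I) Q P ∧ x = Q.encode ∧ y = P.encode := by
    intro hC x y h
    cases hsup _ h with
    | factorVia h hn =>
      obtain ⟨Q, P, h', rfl, rfl⟩ := hclu _ _ h
      exact ⟨Q, P, ⟨h', fun R hR => hn (hcl _ (.factorClusterAbove (hC _ _ hR)))⟩, rfl, rfl⟩
  have hfac : (∀ Q P, IsCluster (viaOf A I) (eqOf I) Q P →
      gat .factorCluster [Q.encode, P.encode] ∈ I) → ∀ x, gat .factor [x] ∈ I →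
      ∃ Q P, IsFac (viaOf A I) (eqOf I) Q P ∧ x = Q.encode := by
    intro hC x h
    cases hsup _ h with
    | factor h =>
      obtain ⟨Q, P, h, he, -⟩ := hfacVia hC _ _ h
      exact ⟨Q, P, h, he⟩
  have hsub : interp (viaOf A I) (eqOf I) ⊆ I := by
    refine interp_subset_of_closed hadm hcl hsort (fun x y h => h)
      (fun i P h => ⟨(hvia _ _ h).1, h⟩) ?_ ?_ ?_
    -- If `infer` were chosen for `P`, the lower bound on `inferVia` would make `P` back-chained, so
    -- the choice must be `fai`.
    · intro P hP ht
      rcases hb.infer_or_fai _ ht with h | h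
      · obtain ⟨i, P', h, he⟩ := hinfer _ h.1
        obtain rfl := HAtom.encode_inj.1 he
        exact absurd h (hP.2 i)
      · exact h.1
    · intro Q h
      obtain ⟨Q', P, h, he⟩ := habove _ h
      obtain rfl := HAtom.encode_inj.1 he
      exact ⟨P, h⟩
    · intro hC Q h
      obtain ⟨Q', P, h, he⟩ := hfac hC _ h
      obtain rfl := HAtom.encode_inj.1 he
      exact ⟨P, h⟩
  have hC : ∀ Q P, IsCluster (viaOf A I) (eqOf I) Q P →
      gat .factorCluster [Q.encode, P.encode] ∈ I := fun Q P h => hsub ⟨Q, P, h, rfl⟩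
  refine Set.Subset.antisymm (fun a ha => ?_) hsub
  have ha' := ha
  cases hsup a ha with
  | goal h => exact ⟨_, h, rfl⟩
  | sortname h => exact ⟨_, h, rfl⟩
  | mayInferVia | inferenceNeeds | pot_goal | pot_needs | tru_goal | tru_needs => exact hfd _ ha'
  | infer =>
    obtain ⟨i, P, h, rfl⟩ := hinfer _ ha'
    exact ⟨i, P, h, rfl⟩
  | fai =>
    obtain ⟨P, h, rfl⟩ := hfai _ ha'
    exact ⟨P, h, rfl⟩
  | inferVia =>
    obtain ⟨-, i, P, -, -, rfl, rfl, -⟩ := hvia _ _ ha'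
    exact ⟨i, P, ha', rfl⟩
  | hu => exact ⟨_, hhu _ ha', rfl⟩
  | uhu => exact ⟨_, (huhu _ ha').1, (huhu _ ha').2, rfl⟩
  | eq_choice | eq_refl => exact ⟨_, _, ha', rfl⟩
  | factorCluster =>
    obtain ⟨Q, P, h, h1, h2⟩ := hclu _ _ ha'
    exact ⟨Q, P, h, by rw [h1, h2]⟩
  | factorClusterAbove =>
    obtain ⟨Q, P, h, rfl⟩ := habove _ ha'
    exact ⟨Q, P, h, rfl⟩
  | factorVia =>
    obtain ⟨Q, P, h, rfl, rfl⟩ := hfacVia hC _ _ ha'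
    exact ⟨Q, P, h, rfl⟩
  | factor =>
    obtain ⟨Q, P, h, rfl⟩ := hfac hC _ ha'
    exact ⟨Q, P, h, rfl⟩
  | abduce h hn =>
    obtain ⟨P, h', rfl⟩ := hfa _ h
    exact ⟨P, h', fun R hR => hn (hsub ⟨P, R, hR, rfl⟩), rfl⟩
  | fa =>
    obtain ⟨P, h, rfl⟩ := hfa _ ha'
    exact ⟨P, h, rfl⟩

end Abduction

namespace Abduction

open ASP AbductionInstance

variable {K : Type u} {A : AbductionInstance K}
  {V : Set (Fin A.B.length × HAtom K)} {E : Set (HTerm K × HTerm K)}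

/-! ### Finiteness of the potential proof graph -/

theorem finite_goals (A : AbductionInstance K) : A.goals.Finite := by
  refine (A.O.finite_toSet.image fun o => o.inst fun v => .app (.obs v) []).subset ?_
  rintro _ ⟨o, ho, rfl⟩
  exact ⟨o, ho, rfl⟩

theorem bodyAtoms_headAtom (i : Fin A.B.length) (σ : ℕ → HTerm K) :
    A.bodyAtoms i (A.headAtom i σ) =
      (fun p => p.inst (A.skolemSubst i σ)) '' {p | p ∈ (A.B.get i).body} := by
  ext Q
  constructor
  · rintro ⟨τ, hτ, p, hp, rfl⟩
    exact ⟨p, hp, by rw [skolemSubst_congr (σ := τ) (τ := σ) hτ]⟩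
  · rintro ⟨p, hp, rfl⟩
    exact mem_bodyAtoms_headAtom hp

theorem finite_bodyAtoms (i : Fin A.B.length) (P : HAtom K) : (A.bodyAtoms i P).Finite := by
  by_cases h : A.Applicable i P
  · obtain ⟨σ, rfl⟩ := h
    exact bodyAtoms_headAtom i σ ▸ (List.finite_toSet _).image _
  · exact Set.finite_empty.subset fun Q hQ => h (applicable_of_mem_bodyAtoms hQ)

theorem nonempty_bodyAtoms {i : Fin A.B.length} {P : HAtom K} (h : A.Applicable i P) :
    (A.bodyAtoms i P).Nonempty := by
  obtain ⟨σ, rfl⟩ := h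
  obtain ⟨p, hp⟩ := List.exists_mem_of_ne_nil _ (A.B.get i).body_ne_nil
  exact ⟨_, mem_bodyAtoms_headAtom hp⟩

/-- There are finitely many clauses, and the transitive closure of an acyclic relation is a strict
order. -/
theorem AbductionInstance.Acyclic.wellFounded (hA : A.Acyclic) :
    WellFounded fun j i => Relation.TransGen A.DependsOn i j := by
  have : IsTrans (Fin A.B.length) fun j i => Relation.TransGen A.DependsOn i j :=
    ⟨fun _ _ _ h h' => h'.trans h⟩
  have : Std.Irrefl fun j i => Relation.TransGen A.DependsOn i j := ⟨hA⟩
  exact Finite.wellFounded_of_trans_of_irrefl _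

/-- Only finitely many atoms can be reached from an atom by back-chaining. -/
theorem finite_descendants (hA : A.Acyclic) {P : HAtom K} :
    {R | Relation.ReflTransGen (fun P Q => ∃ i, Q ∈ A.bodyAtoms i P) P R}.Finite := by
  have split : ∀ P, (∀ i, ∀ Q ∈ A.bodyAtoms i P,
      {R | Relation.ReflTransGen (fun P Q => ∃ i, Q ∈ A.bodyAtoms i P) Q R}.Finite) →
      {R | Relation.ReflTransGen (fun P Q => ∃ i, Q ∈ A.bodyAtoms i P) P R}.Finite := by
    intro P h
    refine ((Set.finite_singleton P).union
      (Set.finite_iUnion fun i => (finite_bodyAtoms i P).biUnion (h i))).subset ?_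
    intro R hR
    rcases hR.cases_head with rfl | ⟨Q, ⟨i, hQ⟩, hR⟩
    · exact .inl rfl
    · exact .inr (Set.mem_iUnion.2 ⟨i, Set.mem_biUnion hQ hR⟩)
  refine split P fun i => ?_
  -- The induction is on the clause, not on the atom: if `Q` arises over clause `i` and can itself
  -- be back-chained over `j`, then `i` depends on `j`. Each atom has finitely many children, so
  -- finiteness passes up by `split`.
  induction i using hA.wellFounded.induction generalizing P with
  | h i ih =>
    exact fun Q hQ => split Q fun j R hR =>
      ih j (.single ⟨P, Q, hQ, applicable_of_mem_bodyAtoms hR⟩) R hR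

theorem finite_potential (hA : A.Acyclic) : {P | A.Potential P}.Finite := by
  refine ((finite_goals A).biUnion fun P _ => finite_descendants hA (P := P)).subset ?_
  intro R hR
  simp only [Set.mem_iUnion, exists_prop]
  induction (show A.Potential R from hR) with
  | @goal P h => exact ⟨P, h, .refl⟩
  | body hP _ hQ ih =>
    obtain ⟨P, hP', h⟩ := ih hP
    exact ⟨P, hP', h.tail ⟨_, hQ⟩⟩

/-! ### Generated graphs -/

namespace GeneratedBy

variable {H : Hypothesis K} {G : InferenceGraph A}

theorem isHypothesis (h : GeneratedBy A H G) : A.IsHypothesis H := by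
  induction h with
  | observation => exact .observation
  | backchain _ hP hi ih => exact .backchain ih hP hi
  | unify _ hP hQ hne hu ih => exact .unify ih hP hQ hne hu

theorem atoms_eq (h : GeneratedBy A H G) : H.atoms = G.nodes := by
  induction h with
  | observation => rfl
  | backchain _ _ _ ih => simp only [ih]
  | unify _ _ _ _ _ ih => exact ih

theorem goals_subset (h : GeneratedBy A H G) : A.goals ⊆ G.nodes := by
  induction h with
  | observation => exact subset_rfl
  | backchain _ _ _ ih => exact ih.trans Set.subset_union_left
  | unify _ _ _ _ _ ih => exact ih

theorem via (h : GeneratedBy A H G) : ∀ i P, (i, P) ∈ G.via →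
    P ∈ G.nodes ∧ A.Applicable i P ∧ A.bodyAtoms i P ⊆ G.nodes := by
  induction h with
  | observation => exact fun _ _ h => h.elim
  | backchain h hP hi ih =>
    rintro j Q (he | hQ)
    · obtain ⟨rfl, rfl⟩ := Prod.mk.inj he
      exact ⟨.inl (h.atoms_eq ▸ hP), hi, Set.subset_union_right⟩
    · obtain ⟨h1, h2, h3⟩ := ih j Q hQ
      exact ⟨.inl h1, h2, h3.trans Set.subset_union_left⟩
  | unify _ _ _ _ _ ih => exact ih

theorem fac (h : GeneratedBy A H G) : ∀ Q P, (Q, P) ∈ G.fac →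
    Q ∈ G.nodes ∧ P ∈ G.nodes ∧ A.Unifiable P Q := by
  induction h with
  | observation => exact fun _ _ h => h.elim
  | backchain _ _ _ ih =>
    intro Q P hQ
    obtain ⟨h1, h2, h3⟩ := ih Q P hQ
    exact ⟨.inl h1, .inl h2, h3⟩
  | unify h hP hQ _ hu ih =>
    rintro R S (he | hR)
    · obtain ⟨rfl, rfl⟩ := Prod.mk.inj he
      exact ⟨h.atoms_eq ▸ hQ, h.atoms_eq ▸ hP, hu⟩
    · exact ih R S hR

theorem mem_eqs (h : GeneratedBy A H G) (e : Sym2 (HTerm K)) :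
    e ∈ H.eqs ↔ ∃ Q P, (Q, P) ∈ G.fac ∧ e ∈ unifEqs P Q := by
  induction h with
  | observation => simp
  | backchain _ _ _ ih => exact ih
  | @unify _ _ _ P Q _ _ _ _ ih =>
    simp only [Set.mem_union, ih, Set.mem_insert_iff, Prod.mk.injEq]
    constructor
    · rintro (⟨R, S, h, he⟩ | he)
      exacts [⟨R, S, .inr h, he⟩, ⟨Q, P, .inl ⟨rfl, rfl⟩, he⟩]
    · rintro ⟨R, S, ⟨rfl, rfl⟩ | h, he⟩
      exacts [.inr he, .inl ⟨R, S, h, he⟩]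

theorem derived (h : GeneratedBy A H G) : ∀ P ∈ G.nodes, A.Derived G.via P := by
  induction h with
  | observation => exact fun P hP => .goal hP
  | @backchain _ G h P hP i hi ih =>
    have hs : G.via ⊆ insert (i, P) G.via := Set.subset_insert _ _
    rintro Q (hQ | hQ)
    · exact (ih Q hQ).mono hs
    · exact .body ((ih P (h.atoms_eq ▸ hP)).mono hs) (Set.mem_insert _ _) hQ
  | unify _ _ _ _ _ ih => exact ih

/-- The recorded back-chainings determine the nodes, whatever the order of the operations. -/
theorem nodes_eq (h : GeneratedBy A H G) : G.nodes = {P | A.Derived G.via P} := by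
  refine Set.Subset.antisymm h.derived fun P hP => ?_
  induction (show A.Derived G.via P from hP) with
  | goal h' => exact h.goals_subset h'
  | body hP hV hQ ih => exact (h.via _ _ hV).2.2 hQ

/-- Any finite set of derived back-chainings can be performed in some order. -/
theorem of_finite_via (hV : V.Finite)
    (h : ∀ i P, (i, P) ∈ V → A.Derived V P ∧ A.Applicable i P) :
    GeneratedBy A ⟨{P | A.Derived V P}, ∅⟩ ⟨{P | A.Derived V P}, V, ∅⟩ := by
  have hfin : {W | W ⊆ V ∧ ∃ N, GeneratedBy A ⟨N, ∅⟩ ⟨N, W, ∅⟩}.Finite :=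
    hV.finite_subsets.subset fun W hW => hW.1
  -- Take a maximal subset `W` of `V` that can be performed. An inference of `V` on an atom already
  -- generated must be in `W`, so all atoms derivable through `V` are generated and `W = V`.
  obtain ⟨W, ⟨hW, N, hN⟩, hmax⟩ := hfin.exists_maximal
    ⟨∅, Set.empty_subset _, A.goals, .observation⟩
  have key : ∀ i P, (i, P) ∈ V → P ∈ N → (i, P) ∈ W := fun i P hi hP =>
    hmax ⟨Set.insert_subset hi hW, _, hN.backchain hP (h i P hi).2⟩
      (Set.subset_insert _ _) (Set.mem_insert _ _)
  have hsub : ∀ P, A.Derived V P → P ∈ N := by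
    intro P hP
    induction hP with
    | goal h' => exact hN.goals_subset h'
    | body hP hV hQ ih => exact (hN.via _ _ (key _ _ hV ih)).2.2 hQ
  obtain rfl : W = V := hW.antisymm fun x hx => key _ _ hx (hsub _ (h _ _ hx).1)
  have := hN.nodes_eq
  simp only at this
  rwa [this] at hN

theorem add_fac {N : Set (HAtom K)} {F : Set (HAtom K × HAtom K)} (hF : F.Finite)
    (hN : GeneratedBy A ⟨N, ∅⟩ ⟨N, V, ∅⟩)
    (h : ∀ Q P, (Q, P) ∈ F → P ∈ N ∧ Q ∈ N ∧ P ≠ Q ∧ A.Unifiable P Q) :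
    GeneratedBy A ⟨N, {e | ∃ Q P, (Q, P) ∈ F ∧ e ∈ unifEqs P Q}⟩ ⟨N, V, F⟩ := by
  induction F, hF using Set.Finite.induction_on with
  | empty => simpa using hN
  | @insert x F hx hF ih =>
    obtain ⟨Q, P⟩ := x
    obtain ⟨hP, hQ, hne, hu⟩ := h Q P (Set.mem_insert _ _)
    have h' := (ih fun Q P hQP => h Q P (Set.mem_insert_of_mem _ hQP)).unify hP hQ hne hu
    convert h' using 2
    ext e
    simp only [Set.mem_insert_iff, Prod.mk.injEq, Set.mem_ofPred_eq, Set.mem_union]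
    constructor
    · rintro ⟨R, S, ⟨rfl, rfl⟩ | h, he⟩
      exacts [.inr he, .inl ⟨R, S, h, he⟩]
    · rintro (⟨R, S, h, he⟩ | he)
      exacts [⟨R, S, .inr h, he⟩, ⟨Q, P, .inl ⟨rfl, rfl⟩, he⟩]

end GeneratedBy

/-! ### The represented explanations are the canonical ones -/

variable [LinearOrder (HTerm K)]

/-- The explanation that is determined by the back-chainings and the equivalence relation. -/
def explain (V : Set (Fin A.B.length × HAtom K)) (E : Set (HTerm K × HTerm K)) :
    Explanation A where
  hyp := ⟨{P | A.Derived V P}, {e | ∃ Q P, (Q, P) ∈ {x : _ × _ | IsFac V E x.1 x.2} ∧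
    e ∈ unifEqs P Q}⟩
  graph := ⟨{P | A.Derived V P}, V, {x | IsFac V E x.1 x.2}⟩
  equiv := E

theorem readOff_interp (V : Set (Fin A.B.length × HAtom K)) (E : Set (HTerm K × HTerm K)) :
    readOff A (interp V E) = explain V E := by
  have e1 : ∀ P : HAtom K, gat .tru [P.encode] ∈ interp V E ↔ A.Derived V P := fun P => by
    simp [mem_interp, extension]
  have e2 : ∀ i P, gat .inferVia [con (.clause i.1), P.encode] ∈ interp V E ↔ (i, P) ∈ V :=
    fun i P => by simp [mem_interp, extension, Fin.val_inj]
  have e3 : ∀ Q P : HAtom K, gat .factorVia [Q.encode, P.encode] ∈ interp V E ↔ IsFac V E Q P :=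
    fun Q P => by simp [mem_interp, extension]
  have e4 : ∀ x y, gat .eq [x, y] ∈ interp V E ↔ (x, y) ∈ E := fun x y => by
    simp [mem_interp, extension]
  simp only [gat] at e1 e2 e3 e4
  simp [readOff, explain, e1, e2, e3, e4]

theorem IsFac.unifiable (hE : IsTermEquivalence A E) {Q P : HAtom K} (h : IsFac V E Q P) :
    A.Unifiable P Q := by
  obtain ⟨⟨-, -, -, hp, hu⟩, -⟩ := h
  refine ⟨hp, hu.imp fun x y hxy => ?_⟩
  by_cases hne : x = y
  · exact .inl hne
  · exact .inr ⟨fun hx => hne (hE.sort_singleton _ _ hxy hx).symm,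
      fun hy => hne (hE.sort_singleton _ _ (hE.symm _ _ hxy) hy)⟩

theorem IsFac.ne {Q P : HAtom K} (h : IsFac V E Q P) : P ≠ Q := by
  rintro rfl
  exact lt_irrefl _ h.1.2.2.1

theorem IsCluster.trans (hE : IsTermEquivalence A E) {Q P R : HAtom K} (h : IsCluster V E Q P)
    (h' : IsCluster V E P R) : IsCluster V E Q R :=
  ⟨h'.1, h.2.1, h'.2.2.1.trans h.2.2.1, unifyUnder_trans hE h'.2.2.2 h.2.2.2⟩

/-- Two targets of `Q` are equivalent to each other; if they differed, the smaller would be a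
cluster partner below the larger. -/
theorem IsFac.unique (hE : IsTermEquivalence A E) {Q P P' : HAtom K} (h : IsFac V E Q P)
    (h' : IsFac V E Q P') : P = P' := by
  have hu := unifyUnder_trans hE h.1.2.2.2 (unifyUnder_symm hE h'.1.2.2.2)
  rcases lt_trichotomy P.encode P'.encode with hlt | he | hlt
  · exact absurd ⟨h.1.1, h'.1.1, hlt, hu⟩ (h'.2 P)
  · exact HAtom.encode_inj.1 he
  · exact absurd ⟨h'.1.1, h.1.1, hlt, unifyUnder_symm hE hu⟩ (h.2 P')

/-- The order on terms need not be well-founded; the least partner exists because there are only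
finitely many potential atoms. -/
theorem IsCluster.exists_isFac (hA : A.Acyclic) (hE : IsTermEquivalence A E) {Q P : HAtom K}
    (h : IsCluster V E Q P) : ∃ R, IsFac V E Q R := by
  have hfin : {R | IsCluster V E Q R}.Finite :=
    (finite_potential hA).subset fun R hR => hR.1.1.potential
  obtain ⟨R, hR, hmin⟩ := Set.exists_min_image _ HAtom.encode hfin ⟨P, h⟩
  exact ⟨R, hR, fun S hS => (hmin S (hR.trans hE hS)).not_gt hS.2.2.1⟩

theorem IsFac.not_edge {Q P R : HAtom K} (h : IsFac V E Q P) :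
    ¬ (explain V E).graph.Edge R P := by
  rintro (⟨i, hi, -⟩ | hf)
  · exact h.1.1.2 i hi
  · exact h.2 R hf.1

/-- A factoring edge starts at an atom without incoming edges, so it lies on no cycle, and every
atom on a cycle is back-chained. Going backwards along the cycle, the clause used at each atom then
depends on the one used at the next, which yields a cycle of clauses. -/
theorem explain_acyclic (hA : A.Acyclic) (h : IsAdmissible V E) (a : HAtom K) :
    ¬ Relation.TransGen (explain V E).graph.Edge a a := by
  have hvia : ∀ a, Relation.TransGen (explain V E).graph.Edge a a → ∃ i, (i, a) ∈ V := by
    intro a ha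
    obtain ⟨x, hx, hxa⟩ := Relation.TransGen.tail'_iff.1 ha
    rcases id hxa with ⟨i, hi, -⟩ | hf
    · exact ⟨i, hi⟩
    · rcases hx.cases_tail with rfl | ⟨c, -, hc⟩
      · exact (IsFac.not_edge hf hxa).elim
      · exact (IsFac.not_edge hf hc).elim
  have hedge : ∀ a b i j, (explain V E).graph.Edge a b → (i, a) ∈ V → (j, b) ∈ V →
      A.DependsOn j i := by
    rintro a b i j (⟨k, hk, hab⟩ | hf) hi hj
    · obtain rfl := h.unique _ _ _ hk hj
      exact ⟨b, a, hab, h.applicable _ _ hi⟩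
    · exact (hf.1.2.1.2 _ hj).elim
  have hdep : ∀ a b, Relation.TransGen (explain V E).graph.Edge a b →
      Relation.TransGen (explain V E).graph.Edge b a →
      -- The return path from `b` to `a` is kept so that the intermediate atoms lie on a cycle as
      -- well and hence are back-chained.
      ∀ i j, (i, a) ∈ V → (j, b) ∈ V → Relation.TransGen A.DependsOn j i := by
    intro a b hab
    induction hab with
    | single hab => exact fun _ i j hi hj => .single (hedge _ _ i j hab hi hj)
    | tail hac hcb ih =>
      intro hba i j hi hj
      have hca := hba.head hcb
      obtain ⟨k, hk⟩ := hvia _ (hca.trans hac)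
      exact (ih hca i k hi hk).head (hedge _ _ k j hcb hk hj)
  intro ha
  obtain ⟨i, hi⟩ := hvia a ha
  exact hA i (hdep a a ha ha i i hi hi)

theorem IsAdmissible.isCanonical (hA : A.Acyclic) (h : IsAdmissible V E) :
    (explain V E).IsCanonical := by
  have hE := h.termEquiv
  have hVfin : V.Finite := (Set.finite_univ.prod (finite_potential hA)).subset
    fun x hx => ⟨trivial, (h.derived x.1 x.2 hx).potential⟩
  have hFfin : {x : HAtom K × HAtom K | IsFac V E x.1 x.2}.Finite :=
    ((finite_potential hA).prod (finite_potential hA)).subset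
      fun x hx => ⟨hx.1.2.1.1.potential, hx.1.1.1.potential⟩
  have hgen : GeneratedBy A (explain V E).hyp (explain V E).graph :=
    GeneratedBy.add_fac hFfin
      (GeneratedBy.of_finite_via hVfin fun i P hi => ⟨h.derived i P hi, h.applicable i P hi⟩)
      fun Q P hf => ⟨hf.1.1.1, hf.1.2.1.1, hf.ne, hf.unifiable hE⟩
  refine ⟨hgen.isHypothesis, ⟨hgen, explain_acyclic hA h, fun P i j => h.unique i j P,
    fun P Q Q' => IsFac.unique hE, fun P i Q hi hf => hf.1.2.1.2 i hi⟩, hE, ?_, ?_, ?_, ?_⟩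
  · rintro x y ⟨Q, P, hf, x', y', hz, -, he⟩
    have := List.forall₂_zip hf.1.2.2.2.2 hz
    -- Equivalences of a hypothesis are unordered, so either orientation may occur.
    rcases Sym2.eq_iff.1 he with ⟨rfl, rfl⟩ | ⟨rfl, rfl⟩
    exacts [this, hE.symm _ _ this]
  · exact fun Q P hf => ⟨hf.1.1.1, fun ⟨R, hR⟩ => hf.not_edge hR⟩
  · exact fun Q P hf => hf.1.2.2.1
  · have hfa : ∀ P ∈ (explain V E).graph.abduced, IsFa V P := fun P hP =>
      ⟨hP.1, fun i hi => by
        obtain ⟨Q, hQ⟩ := nonempty_bodyAtoms (h.applicable i P hi)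
        exact hP.2 ⟨Q, .inl ⟨i, hi, hQ⟩⟩⟩
    intro Q hQ P hP hlt hu
    obtain ⟨R, hR⟩ := IsCluster.exists_isFac (V := V) hA hE ⟨hfa P hP, hfa Q hQ, hlt, hu⟩
    exact hQ.2 ⟨R, .inr hR⟩

/-- The point is that the factorings of `X` are forced. The nodes are given by `nodes_eq` and the
equivalences by `mem_eqs`. -/
theorem Explanation.IsCanonical.eq_explain {X : Explanation A} (hX : X.IsCanonical) :
    IsAdmissible X.graph.via X.equiv ∧ X = explain X.graph.via X.equiv := by
  have hgen := hX.proofGraph.generated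
  have hE := hX.termEquiv
  refine ⟨⟨fun i P hi => hgen.derived P (hgen.via i P hi).1, fun i P hi => (hgen.via i P hi).2.1,
    fun i j P => hX.proofGraph.via_unique P i j, hE⟩, ?_⟩
  have hnode : ∀ P, P ∈ X.graph.nodes ↔ A.Derived X.graph.via P := fun P => by
    rw [hgen.nodes_eq]; rfl
  have hunify : ∀ Q P, (Q, P) ∈ X.graph.fac → UnifyUnder X.equiv P Q := by
    intro Q P hf
    obtain ⟨-, hP, hp, hu⟩ := hgen.fac Q P hf
    refine ⟨hp, List.forall₂_iff_zip.2 ⟨hu.length_eq, fun {x y} hxy => ?_⟩⟩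
    by_cases hne : x = y
    · subst hne
      exact hE.refl _ (mem_herbrandTerms.2
        ⟨P, ((hnode P).1 hP).potential, (List.of_mem_zip hxy).1⟩)
    · exact hX.supported _ _ ((hgen.mem_eqs _).2 ⟨Q, P, hf, x, y, hxy, hne, rfl⟩)
  have habd : ∀ P ∈ X.graph.abduced, IsFa X.graph.via P := fun P hP =>
    ⟨(hnode P).1 hP.1, fun i hi => by
      obtain ⟨Q, hQ⟩ := nonempty_bodyAtoms (hgen.via i P hi).2.1
      exact hP.2 ⟨Q, .inl ⟨i, hi, hQ⟩⟩⟩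
  have hfa : ∀ P, IsFa X.graph.via P → P ∈ X.graph.abduced ∨ ∃ R, (P, R) ∈ X.graph.fac := by
    intro P hP
    by_contra! hn
    refine hn.1 ⟨(hnode P).2 hP.1, ?_⟩
    rintro ⟨R, ⟨i, hi, -⟩ | hR⟩
    exacts [hP.2 i hi, hn.2 R hR]
  have hclus : ∀ Q P, (Q, P) ∈ X.graph.fac → IsCluster X.graph.via X.equiv Q P := fun Q P hf =>
    ⟨habd P (hX.fac_abduced Q P hf), ⟨(hnode Q).1 (hgen.fac Q P hf).1,
      fun i hi => hX.proofGraph.via_or_fac Q i P hi hf⟩, hX.fac_smaller Q P hf, hunify Q P hf⟩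
  -- A smaller partner `R` of an abduced atom `P` is either abduced itself or factored with a still
  -- smaller abduced atom `S`; by transitivity `P` would unify with an abduced smaller atom, against
  -- completeness of factoring.
  have hleast : ∀ P ∈ X.graph.abduced, ∀ R, ¬ IsCluster X.graph.via X.equiv P R := by
    intro P hP R hR
    rcases hfa R hR.1 with hR' | ⟨S, hS⟩
    · exact hX.fac_complete P hP R hR' hR.2.2.1 hR.2.2.2
    · have := hR.trans hE (hclus R S hS)
      exact hX.fac_complete P hP S (hX.fac_abduced R S hS) this.2.2.1 this.2.2.2
  have hfac : ∀ Q P, (Q, P) ∈ X.graph.fac ↔ IsFac X.graph.via X.equiv Q P := by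
    intro Q P
    constructor
    · exact fun hf => ⟨hclus Q P hf, hleast P (hX.fac_abduced Q P hf)⟩
    -- By `hleast` an atom with a smaller partner is not abduced, so it is factored with some `R`;
    -- that `R` is also least in the cluster, hence equal to `P`.
    · intro hf
      have hQ : ∃ R, (Q, R) ∈ X.graph.fac := by
        refine (hfa Q hf.1.2.1).resolve_left fun hQ => hleast Q hQ P hf.1
      obtain ⟨R, hR⟩ := hQ
      rwa [hf.unique hE ⟨hclus Q R hR, hleast R (hX.fac_abduced Q R hR)⟩]
  have hfac' : X.graph.fac = {x | IsFac X.graph.via X.equiv x.1 x.2} :=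
    Set.ext fun x => hfac x.1 x.2
  refine Explanation.ext (Hypothesis.ext ?_ ?_) (InferenceGraph.ext ?_ rfl hfac') rfl
  · rw [hgen.atoms_eq, hgen.nodes_eq]; rfl
  · ext e
    rw [hgen.mem_eqs, hfac']
    rfl
  · exact hgen.nodes_eq

end Abduction

/-! ### The bijection -/

theorem mainTheorem2 {K : Type u} [LinearOrder (ASP.GroundTerm (Abduction.Sym K))]
    (A : Abduction.AbductionInstance K) (hA : A.Acyclic) :
    Set.BijOn (Abduction.readOff A) (ASP.answerSets (Abduction.progBwda A))
      {X | X.IsCanonical} := by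
  refine ⟨fun I hI => ?_, fun I hI I' hI' he => ?_, fun X hX => ?_⟩
  · obtain ⟨hadm, he⟩ := ASP.IsAnswerSet.eq_interp hI
    rw [he, Abduction.readOff_interp]
    exact hadm.isCanonical hA
  -- The graph and the equivalence retain `V` and `E`, and these determine the answer set.
  · have hv : Abduction.viaOf A I = Abduction.viaOf A I' :=
      congrArg (fun X : Abduction.Explanation A => X.graph.via) he
    have hq : Abduction.eqOf I = Abduction.eqOf I' :=
      congrArg (fun X : Abduction.Explanation A => X.equiv) he
    rw [(ASP.IsAnswerSet.eq_interp hI).2, (ASP.IsAnswerSet.eq_interp hI').2, hv, hq]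
  · obtain ⟨hadm, he⟩ := Abduction.Explanation.IsCanonical.eq_explain hX
    exact ⟨_, hadm.isAnswerSet, by rw [Abduction.readOff_interp, ← he]⟩
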